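/- Write $\mathbb D$ for the open unit disc, $\mathbb T$ for the unit circle and $H^p\subset L^p=L^p(\mathbb T)$ for the Hardy space of functions with vanishing Fourier coefficients of negative index. Let $\mathbb P$ be the Riesz projection of $L^p$ onto $H^p$, and $\mathrm{Rat}_0(\mathbb T)$ the set of strictly proper complex rational functions with poles only on $\mathbb T$. For $1<p<\infty$ and a rational function $\omega$, possibly with poles on $\mathbb T$, the Toeplitz-like operator $T_\omega$ on $H^p$ is defined by $$\mathrm{Dom}(T_\omega)=\{g\in H^p : \omega g=f+\rho \text{ with } f\in L^p,\ \rho\in \mathrm{Rat}_0(\mathbb T)\},\qquad T_\omega g=\mathbb P f .$$ Let $p'$ be given by $1/p+1/p'=1$, and identify $(H^p)'$ with $H^{p'}$ through the pairing $\langle f,g\rangle=\frac1{2\pi}\int_{\mathbb T} f(z)\overline{g(z)}\,|dz|$; thus $T_\omega^*$ acts in $H^{p'}$. Let $\omega^*$ be the rational function with $\omega^*(z)=\overline{\omega(z)}$ on $\mathbb T$; $T_{\omega^*}$ and the other Toeplitz operators below act in $H^{p'}$. For a polynomial $r$ of degree $k$ put $r^\sharp(z)=z^k\,\overline{r(1/\bar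 z)}$. For $k\in\mathbb Z$ let $Q_k=I-P_{k-1}$ on $H^{p'}$, where $P_{k-1}f=\sum_{0\le j<k}\hat f(j)z^j$ is the standard projection onto the polynomials of degree at most $k-1$ (so $Q_k=I$ for $k\le 0$). **Theorem.** Let $1<p<\infty$ and let $\omega=s/q\ne 0$ with $s,q$ coprime complex polynomials. Factor $s=s_-s_0s_+$ and $q=q_-q_0q_+$ into polynomials such that $s_-,q_-$ have roots only in $\mathbb D$, $s_0,q_0$ only on $\mathbb T$, and $s_+,q_+$ only outside $\overline{\mathbb D}$. Put $m=\deg q$, $n=\deg s$, $m_\pm=\deg q_\pm$, $n_\pm=\deg s_\pm$, $m_0=\deg q_0$, $n_0=\deg s_0$. Then $T_\omega$, its adjoint $T_\omega^*$ and $T_{\omega^*}$ are well-defined (single-valued) operators and: 1. $\mathrm{Dom}(T_\omega^*)=(q_0)^\sharp H^{p'}\subset \mathrm{Dom}(T_{\omega^*})$ and $T_\omega^*=T_{\omega^*}|_{(q_0)^\sharp H^{p'}}$. 2. $\mathrm{Ran}(T_\omega^*)=T_{z^{m-n}(s_+)^\sharp/(q_+)^\sharp}\,Q_{n_0+n_--m_0-m_-}\,(s_0)^\sharp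 H^{p'}$; and if $n_0+n_-\le m_0+m_-$, then $\mathrm{Ran}(T_\omega^*)=T_{z^{m-n}/(q_+)^\sharp}\,(s_+s_0)^\sharp H^{p'}$. 3. $\mathrm{Ker}(T_\omega^*)=\left\{\dfrac{(q_-)^\sharp(q_0)^\sharp r}{(s_-)^\sharp} : r \text{ a polynomial with } \deg r<n_--m_--m_0\right\}$ (with $\deg 0=-\infty$). 4. $\dim\mathrm{Ker}(T_\omega^*)=\max\{0,\ \#\{\text{zeroes of }\omega\text{ in }\mathbb D\}-\#\{\text{poles of }\omega\text{ in }\overline{\mathbb D}\}\}=\max\{0,\ n_--m_--m_0\}$, with multiplicities counted. 5. $T_\omega^*$ is injective if and only if the number of poles of $\omega$ in $\overline{\mathbb D}$ is at least the number of zeroes of $\omega$ in $\mathbb D$, with multiplicities counted. -/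

import Mathlib

open MeasureTheory Polynomial ComplexConjugate
open scoped ENNReal

namespace ToeplitzLike

noncomputable section

/-! ### The unit circle, `L^p` and `H^p`

The unit circle is parametrized by `UnitAddCircle = ℝ / ℤ`, `x ↦ exp (2 π i x)`, and carries
normalized arc length, i.e. the probability Haar measure. -/

/-- Normalized arc length on the circle. -/
abbrev arc : Measure UnitAddCircle := AddCircle.haarAddCircle

/-- The point `exp (2 π i x)` of the unit circle. -/
def pt (x : UnitAddCircle) : ℂ := (AddCircle.toCircle x : ℂ)

/-- `L^p` of the unit circle. -/
abbrev LpT (p : ℝ≥0∞) : Type := Lp ℂ p arc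

theorem integrable_LpT {p : ℝ≥0∞} [Fact (1 ≤ p)] (f : LpT p) : Integrable f arc :=
  (Lp.memLp f).integrable Fact.out

/-- The `n`-th Fourier coefficient as a linear functional on `L^p`. -/
def coeffL (p : ℝ≥0∞) [Fact (1 ≤ p)] (n : ℤ) : LpT p →ₗ[ℂ] ℂ where
  toFun f := fourierCoeff f n
  map_add' f g := by
    rw [fourierCoeff_congr_ae (Lp.coeFn_add f g),
      fourierCoeff.add (integrable_LpT f) (integrable_LpT g)]
    rfl
  map_smul' c f := by
    rw [fourierCoeff_congr_ae (Lp.coeFn_smul c f), fourierCoeff.const_smul]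
    rfl

/-- The Hardy space `H^p`, as the subspace of those `f` in `L^p` of the circle
whose Fourier coefficients of negative index vanish. -/
def Hardy (p : ℝ≥0∞) [Fact (1 ≤ p)] : Submodule ℂ (LpT p) where
  carrier := {f | ∀ n : ℤ, n < 0 → coeffL p n f = 0}
  add_mem' {f g} hf hg n hn := by rw [map_add, hf n hn, hg n hn, add_zero]
  zero_mem' n _ := map_zero _
  smul_mem' c f hf n hn := by rw [map_smul, hf n hn, smul_zero]

/-- `h = ℙ f`, where `ℙ` is the Riesz projection of `L^p` onto `H^p`: `h` lies in `H^p` and has the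
same Fourier coefficients of nonnegative index as `f`. For `1 < p < ∞` every `f` in `L^p` has exactly
one such `h`. -/
def IsRieszProj {p : ℝ≥0∞} [Fact (1 ≤ p)] (f : LpT p) (h : Hardy p) : Prop :=
  ∀ n : ℤ, 0 ≤ n → coeffL p n (h : LpT p) = coeffL p n f

/-! ### Linear operators as graphs

A possibly unbounded linear operator `E → F` is represented by its graph, a subspace of `E × F`. -/

section Operators

variable {E F : Type*} [AddCommGroup E] [Module ℂ E] [AddCommGroup F] [Module ℂ F]

/-- The subspace `A` is the graph of an operator: every vector has at most one image. -/
def IsSingleValued (A : Submodule ℂ (E × F)) : Prop :=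
  ∀ g k k', (g, k) ∈ A → (g, k') ∈ A → k = k'

/-- Distinct vectors have distinct images. -/
def IsInjective (A : Submodule ℂ (E × F)) : Prop :=
  ∀ g g' k, (g, k) ∈ A → (g', k) ∈ A → g = g'

/-- The domain of an operator. -/
def dom (A : Submodule ℂ (E × F)) : Submodule ℂ E := A.map (LinearMap.fst ℂ E F)

/-- The range of an operator. -/
def ran (A : Submodule ℂ (E × F)) : Submodule ℂ F := A.map (LinearMap.snd ℂ E F)

/-- The kernel of an operator. -/
def ker (A : Submodule ℂ (E × F)) : Submodule ℂ E := A.comap (LinearMap.inl ℂ E F)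

/-- The restriction of an operator to a subspace `S`. -/
def restrict (A : Submodule ℂ (E × F)) (S : Submodule ℂ E) : Submodule ℂ (E × F) := A ⊓ S.prod ⊤

/-- The image `A S` of a subspace `S` under an operator. -/
def image (A : Submodule ℂ (E × F)) (S : Submodule ℂ E) : Submodule ℂ F := ran (restrict A S)

end Operators

/-! ### Rational functions on the circle -/

/-- The values of a rational function on the circle (meaningful away from the finitely many
poles, that is, almost everywhere). -/
def onCircle (ω : RatFunc ℂ) (x : UnitAddCircle) : ℂ := ω.eval (RingHom.id ℂ) (pt x)

/-- The class `Rat₀(𝕋)`: strictly proper rational functions with poles only on the unit circle. -/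
def IsRatZero (ρ : RatFunc ℂ) : Prop :=
  ρ.num.degree < ρ.denom.degree ∧ ∀ z : ℂ, ρ.denom.IsRoot z → ‖z‖ = 1

/-- The symbol `ω^*` given by `ω^*(z) = conj (ω(z))` on the circle. -/
def starSymbol (φ : UnitAddCircle → ℂ) (x : UnitAddCircle) : ℂ := conj (φ x)

/-- `r^♯(z) = z^k * conj (r (1 / conj z))` with `k = deg r`: the coefficients are conjugated and
their order is reversed. -/
def sharp (r : ℂ[X]) : ℂ[X] := (r.map (starRingEnd ℂ)).reverse

/-- The number of zeroes of `ω` in the open unit disc, with multiplicities. -/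
def numZerosDisc (ω : RatFunc ℂ) : ℕ := by
  classical exact (ω.num.roots.filter (fun z => ‖z‖ < 1)).card

/-- The number of poles of `ω` in the closed unit disc, with multiplicities. -/
def numPolesClosedDisc (ω : RatFunc ℂ) : ℕ := by
  classical exact (ω.denom.roots.filter (fun z => ‖z‖ ≤ 1)).card

theorem pt_injective : Function.Injective pt := fun _ _ h =>
  AddCircle.injective_toCircle one_ne_zero (Subtype.ext h)

theorem ae_eval_ne_zero {r : ℂ[X]} (hr : r ≠ 0) : ∀ᵐ x ∂arc, r.eval (pt x) ≠ 0 := by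
  have hfin : {x : UnitAddCircle | r.eval (pt x) = 0}.Finite := by
    refine Set.Finite.preimage (f := pt) pt_injective.injOn (s := {z | r.eval z = 0}) ?_
    refine r.roots.toFinset.finite_toSet.subset fun z hz => ?_
    simpa [hr] using hz
  have hvol : (volume : Measure UnitAddCircle) = arc := by
    rw [AddCircle.volume_eq_smul_haarAddCircle]; simp
  have hpt : ∀ x : UnitAddCircle, arc {x} = 0 := fun x => by
    have h := AddCircle.volume_closedBall (T := 1) (x := x) 0
    rw [Metric.closedBall_zero, hvol] at h
    simpa using h
  have : arc {x : UnitAddCircle | r.eval (pt x) = 0} = 0 := by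
    rw [← Set.biUnion_of_singleton {x : UnitAddCircle | r.eval (pt x) = 0},
      measure_biUnion_null_iff hfin.countable]
    exact fun x _ => hpt x
  simpa [ae_iff] using this

theorem onCircle_add (ρ σ : RatFunc ℂ) :
    ∀ᵐ x ∂arc, onCircle (ρ + σ) x = onCircle ρ x + onCircle σ x := by
  filter_upwards [ae_eval_ne_zero ρ.denom_ne_zero, ae_eval_ne_zero σ.denom_ne_zero] with x h1 h2
  exact RatFunc.eval_add _ _ h1 h2

theorem onCircle_smul (c : ℂ) (ρ : RatFunc ℂ) :
    ∀ᵐ x ∂arc, onCircle (RatFunc.C c * ρ) x = c * onCircle ρ x := by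
  filter_upwards [ae_eval_ne_zero ρ.denom_ne_zero] with x h1
  have h := RatFunc.eval_mul (RingHom.id ℂ) (pt x) (x := RatFunc.C c) (y := ρ) (by simp) h1
  simpa [onCircle] using h

theorem isRatZero_zero : IsRatZero 0 := by
  refine ⟨by simp, fun z hz => ?_⟩
  simp at hz

theorem IsRatZero.add {ρ σ : RatFunc ℂ} (hρ : IsRatZero ρ) (hσ : IsRatZero σ) :
    IsRatZero (ρ + σ) := by
  refine ⟨?_, fun z hz => ?_⟩
  · have h := congrArg Polynomial.degree (RatFunc.num_denom_add ρ σ)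
    have hD : (ρ.denom * σ.denom).degree ≠ ⊥ :=
      mt degree_eq_bot.1 (mul_ne_zero ρ.denom_ne_zero σ.denom_ne_zero)
    have hd : (ρ + σ).denom.degree ≠ ⊥ := mt degree_eq_bot.1 (ρ + σ).denom_ne_zero
    have h1 : ρ.num.degree + σ.denom.degree < ρ.denom.degree + σ.denom.degree :=
      WithBot.add_lt_add_right (mt degree_eq_bot.1 σ.denom_ne_zero) hρ.1
    have h2 : ρ.denom.degree + σ.num.degree < ρ.denom.degree + σ.denom.degree :=
      WithBot.add_lt_add_left (mt degree_eq_bot.1 ρ.denom_ne_zero) hσ.1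
    have h3 : (ρ.num * σ.denom + ρ.denom * σ.num).degree < (ρ.denom * σ.denom).degree := by
      refine lt_of_le_of_lt (degree_add_le _ _) ?_
      rw [degree_mul, degree_mul, degree_mul]
      exact max_lt h1 h2
    by_contra hcon
    rw [not_lt] at hcon
    rw [degree_mul (p := (ρ + σ).num),
      degree_mul (p := ρ.num * σ.denom + ρ.denom * σ.num)] at h
    have h4 := WithBot.add_lt_add_right hd h3
    rw [← h, add_comm] at h4
    have h5 : (ρ + σ).denom.degree + (ρ.denom * σ.denom).degree
        ≤ (ρ + σ).num.degree + (ρ.denom * σ.denom).degree := by gcongr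
    exact absurd (lt_of_lt_of_le (by simpa [add_comm] using h4) h5) (by simp [add_comm])
  · have h := (RatFunc.denom_add_dvd ρ σ)
    have h' : (ρ.denom * σ.denom).IsRoot z := hz.dvd h
    rcases root_mul.1 h' with h' | h'
    · exact hρ.2 z h'
    · exact hσ.2 z h'

theorem IsRatZero.smul (c : ℂ) {ρ : RatFunc ℂ} (hρ : IsRatZero ρ) :
    IsRatZero (RatFunc.C c * ρ) := by
  refine ⟨?_, fun z hz => ?_⟩
  · have h := congrArg Polynomial.degree (RatFunc.num_denom_mul (RatFunc.C c) ρ)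
    have hd : (RatFunc.C c * ρ).denom.degree ≠ ⊥ :=
      mt degree_eq_bot.1 (RatFunc.C c * ρ).denom_ne_zero
    simp only [RatFunc.denom_C, RatFunc.num_C, one_mul, degree_mul] at h
    have h3 : (Polynomial.C c).degree + ρ.num.degree < ρ.denom.degree := by
      refine lt_of_le_of_lt ?_ hρ.1
      calc _ ≤ 0 + ρ.num.degree := by gcongr; exact degree_C_le
        _ = _ := zero_add _
    by_contra hcon
    rw [not_lt] at hcon
    have h4 := WithBot.add_lt_add_right hd h3
    rw [← h] at h4
    have h5 : ρ.denom.degree + (RatFunc.C c * ρ).denom.degree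
        ≤ (RatFunc.C c * ρ).num.degree + ρ.denom.degree := by
      rw [add_comm]; gcongr
    exact absurd (lt_of_lt_of_le h4 h5) (lt_irrefl _)
  · have h := RatFunc.denom_mul_dvd (RatFunc.C c) ρ
    rw [RatFunc.denom_C, one_mul] at h
    exact hρ.2 z (hz.dvd h)

/-! ### The Toeplitz-like operator and its adjoint -/

/-- The Toeplitz-like operator `T_φ` on `H^p`: the domain consists of those `g` in `H^p` with
`φ g = f + ρ` for some `f` in `L^p` and `ρ` in `Rat₀(𝕋)`, and then `T_φ g = ℙ f`. -/
def toeplitz (p : ℝ≥0∞) [Fact (1 ≤ p)] (φ : UnitAddCircle → ℂ) :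
    Submodule ℂ (Hardy p × Hardy p) where
  carrier := {gk | ∃ (f : LpT p) (ρ : RatFunc ℂ), IsRatZero ρ ∧
    (∀ᵐ x ∂arc, φ x * (gk.1 : LpT p) x = f x + onCircle ρ x) ∧ IsRieszProj f gk.2}
  add_mem' := by
    rintro ⟨g, k⟩ ⟨g', k'⟩ ⟨f, ρ, hρ, he, hP⟩ ⟨f', ρ', hρ', he', hP'⟩
    refine ⟨f + f', ρ + ρ', hρ.add hρ', ?_, fun n hn => ?_⟩
    · filter_upwards [he, he', onCircle_add ρ ρ', Lp.coeFn_add f f',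
        Lp.coeFn_add (g : LpT p) (g' : LpT p)] with x h1 h2 h3 h4 h5
      simp only [Prod.mk_add_mk, Submodule.coe_add] at h1 h2 ⊢
      rw [h5, h4, h3, Pi.add_apply, Pi.add_apply, mul_add, h1, h2]
      ring
    · simp only [Prod.mk_add_mk, Submodule.coe_add, map_add]
      rw [hP n hn, hP' n hn]
  zero_mem' := by
    refine ⟨0, 0, isRatZero_zero, ?_, fun n _ => rfl⟩
    exact Filter.Eventually.of_forall fun x => by simp [onCircle]
  smul_mem' := by
    rintro c ⟨g, k⟩ ⟨f, ρ, hρ, he, hP⟩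
    refine ⟨c • f, RatFunc.C c * ρ, hρ.smul c, ?_, fun n hn => ?_⟩
    · filter_upwards [he, onCircle_smul c ρ, Lp.coeFn_smul c f,
        Lp.coeFn_smul c (g : LpT p)] with x h1 h3 h4 h5
      simp only [Prod.smul_mk, Submodule.coe_smul] at h1 ⊢
      rw [h5, h4, h3, Pi.smul_apply, Pi.smul_apply, smul_eq_mul, smul_eq_mul, mul_left_comm, h1]
      ring
    · simp only [Prod.smul_mk, Submodule.coe_smul, map_smul]
      rw [hP n hn]

/-- The pairing `⟨f, g⟩ = (1 / 2π) ∫_𝕋 conj (g(z)) f(z) |dz|`. -/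
def pairing {p p' : ℝ≥0∞} (f : LpT p) (g : LpT p') : ℂ := ∫ x, conj (g x) * f x ∂arc

theorem integrable_pairing {p p' : ℝ≥0∞} [ENNReal.HolderConjugate p p']
    (f : LpT p) (g : LpT p') : Integrable (fun x => conj (g x) * f x) arc := by
  have : ENNReal.HolderConjugate p' p := ENNReal.HolderTriple.symm
  exact MemLp.integrable_mul (p := p') (q := p) (Lp.memLp g).star (Lp.memLp f)

theorem pairing_add_right {p p' : ℝ≥0∞} [ENNReal.HolderConjugate p p']
    (f : LpT p) (g g' : LpT p') : pairing f (g + g') = pairing f g + pairing f g' := by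
  rw [pairing, pairing, pairing, ← integral_add (integrable_pairing f g) (integrable_pairing f g')]
  refine integral_congr_ae ?_
  filter_upwards [Lp.coeFn_add g g'] with x h
  rw [h, Pi.add_apply, map_add, add_mul]

theorem pairing_smul_right {p p' : ℝ≥0∞} (c : ℂ)
    (f : LpT p) (g : LpT p') : pairing f (c • g) = conj c * pairing f g := by
  rw [pairing, pairing, ← integral_const_mul]
  refine integral_congr_ae ?_
  filter_upwards [Lp.coeFn_smul c g] with x h
  rw [h, Pi.smul_apply, smul_eq_mul, map_mul, mul_assoc]

theorem pairing_zero_right {p p' : ℝ≥0∞} (f : LpT p) : pairing f (0 : LpT p') = 0 := by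
  have := pairing_smul_right (0 : ℂ) f (0 : LpT p')
  simpa using this

/-- The adjoint of an operator `T` on `H^p`, as an operator on `H^{p'}`, with respect to the
identification of the dual of `H^p` with `H^{p'}` through the pairing: `g` is in the domain of
`T^*` with `T^* g = k` when `⟨T f, g⟩ = ⟨f, k⟩` for all `f` in the domain of `T`. -/
def adjoint {p p' : ℝ≥0∞} [Fact (1 ≤ p)] [Fact (1 ≤ p')] [ENNReal.HolderConjugate p p']
    (T : Submodule ℂ (Hardy p × Hardy p)) : Submodule ℂ (Hardy p' × Hardy p') where
  carrier := {gk | ∀ f h : Hardy p, (f, h) ∈ T →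
    pairing (h : LpT p) (gk.1 : LpT p') = pairing (f : LpT p) (gk.2 : LpT p')}
  add_mem' := by
    rintro ⟨g, k⟩ ⟨g', k'⟩ h1 h2 f h hT
    simp only [Prod.mk_add_mk, Submodule.coe_add, pairing_add_right]
    rw [h1 f h hT, h2 f h hT]
  zero_mem' := by
    intro f h _
    simp [pairing_zero_right]
  smul_mem' := by
    rintro c ⟨g, k⟩ h1 f h hT
    simp only [Prod.smul_mk, Submodule.coe_smul, pairing_smul_right]
    rw [h1 f h hT]

/-! ### The subspaces `r H^p` and the projections `Q_k` -/

/-- The subspace `r H^p` of `H^p`, for a polynomial `r`. -/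
def polyMul (p : ℝ≥0∞) [Fact (1 ≤ p)] (r : ℂ[X]) : Submodule ℂ (Hardy p) where
  carrier := {g | ∃ h : Hardy p, ∀ᵐ x ∂arc, (g : LpT p) x = r.eval (pt x) * (h : LpT p) x}
  add_mem' := by
    rintro g g' ⟨h, hh⟩ ⟨h', hh'⟩
    refine ⟨h + h', ?_⟩
    filter_upwards [hh, hh', Lp.coeFn_add (g : LpT p) (g' : LpT p),
      Lp.coeFn_add (h : LpT p) (h' : LpT p)] with x h1 h2 h3 h4
    rw [Submodule.coe_add, Submodule.coe_add, h3, h4, Pi.add_apply, Pi.add_apply, h1, h2, mul_add]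
  zero_mem' := by
    refine ⟨0, ?_⟩
    exact Filter.Eventually.of_forall fun x => by simp
  smul_mem' := by
    rintro c g ⟨h, hh⟩
    refine ⟨c • h, ?_⟩
    filter_upwards [hh, Lp.coeFn_smul c (g : LpT p), Lp.coeFn_smul c (h : LpT p)] with x h1 h2 h3
    rw [Submodule.coe_smul, Submodule.coe_smul, h2, h3, Pi.smul_apply, Pi.smul_apply, h1,
      smul_eq_mul, smul_eq_mul, mul_left_comm]

theorem fourierCoeff_fourier (m n : ℤ) :
    fourierCoeff (fun x : UnitAddCircle => fourier m x) n = if m = n then 1 else 0 := by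
  have h := (orthonormal_iff_ite.1 (orthonormal_fourier (T := 1))) n m
  rw [ContinuousMap.inner_toLp (𝕜 := ℂ) arc (fourier n) (fourier m)] at h
  rw [fourierCoeff]
  simp only [fourier_neg, smul_eq_mul]
  simp only [eq_comm (a := m)]
  rw [← h]
  refine integral_congr_ae (Filter.Eventually.of_forall fun x => ?_)
  simp [mul_comm]

/-- The monomial `z^j` as an element of `H^p`. -/
def monomialH (p : ℝ≥0∞) [Fact (1 ≤ p)] (j : ℕ) : Hardy p :=
  ⟨fourierLp p (j : ℤ), fun n hn => by
    change fourierCoeff _ n = 0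
    rw [fourierCoeff_congr_ae (coeFn_fourierLp p (j : ℤ))]
    have h := fourierCoeff_fourier (j : ℤ) n
    rw [if_neg (by omega)] at h
    exact h⟩

/-- The standard projection of `H^p` onto the polynomials of degree at most `k - 1`,
`f ↦ ∑_{j < k} f_j z^j`; it is `0` for `k ≤ 0`. -/
def polyProj (p : ℝ≥0∞) [Fact (1 ≤ p)] (k : ℤ) : Hardy p →ₗ[ℂ] Hardy p :=
  ∑ j ∈ Finset.range k.toNat, ((coeffL p j).comp (Hardy p).subtype).smulRight (monomialH p j)

/-- `Q_k = I - P_{𝒫_{k-1}}`; it is the identity for `k ≤ 0`. -/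
def Qproj (p : ℝ≥0∞) [Fact (1 ≤ p)] (k : ℤ) : Hardy p →ₗ[ℂ] Hardy p :=
  LinearMap.id - polyProj p k

end

end ToeplitzLike

open ToeplitzLike

namespace ToeplitzLike

open Filter Topology

/-! ### Fourier coefficients -/

/-! Everything is read off Fourier coefficients. Call a function co-Hardy if its coefficients of
index `≥ 0` vanish. Polynomials multiply `H^p` into itself, conjugated polynomials do so for
co-Hardy functions, and a polynomial factor with all roots of modulus `≥ 1` can be cancelled when
the quotient is in `L^p`: otherwise the recursion on coefficients contradicts Riemann–Lebesgue.
Boundedness of the Riesz projection is not used; each projection needed is built from such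
multiplications and divisions.

Domain: let `T_ω^* g = k`. By partial fractions polynomials lie in the domain of `T_ω`, so they can
serve as test functions. Testing with `z^j q` shows that `u = conj s · g - conj q · k` is co-Hardy.
Take `α s + β q_0 = 1`; testing with `z^j q_- q_+ α`, `j < m_0`, shows that `v = conj β · g + conj
(q_- q_+ α) · k` has zero coefficients at `0 ≤ j < m_0`, so `ℙ v = z^{m_0} h` with `h` in `H^{p'}`.
As `g = conj q_0 · v + conj α · u`, it differs from `conj q_0 · z^{m_0} h = q_0^♯ h` by a function
both Hardy and co-Hardy, hence zero. Conversely, for `g = q_0^♯ h` the singular part `ρ` of `ω f` is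
paired into `⟨z^{-m_0} q_0 ρ, h⟩`, which vanishes because `q_0 ρ` is a polynomial of degree `< m_0`
(`mem_polyMul_of_mem_adjoint`, `mem_adjoint`).

Kernel: `ω^* q_0^♯ h = conj s · w / conj q_+` with `w = z^{m_0+m_-} h / q_-^♯` Hardy. Cancelling
`conj (s_0 s_+)` and `conj q_+`, this is co-Hardy iff `z^{-(n_- - m_- - m_0)} s_-^♯ h / q_-^♯` is,
i.e. iff `s_-^♯ h / q_-^♯` is a polynomial of degree `< n_- - m_- - m_0`
(`memCoHardy_starSymbol_mul_iff`).

Range: the same function equals `z^{m-n} s_+^♯ / q_+^♯ · s_0^♯ h'`, where `h' = s_-^♯ h / q_-^♯`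
runs over all of `H^{p'}` (`rangeSymbol_mul_eq`). That symbol makes polynomials of degree `< n_0 +
n_- - m_0 - m_-` co-Hardy, so the projection `Q` can be inserted for free. -/

theorem pt_eq_fourier (x : UnitAddCircle) : pt x = fourier 1 x := by
  rw [fourier_one]; rfl

theorem continuous_pt : Continuous pt := by
  have : pt = fun x => fourier 1 x := funext pt_eq_fourier
  rw [this]; exact (fourier 1).continuous

theorem norm_pt (x : UnitAddCircle) : ‖pt x‖ = 1 := Circle.norm_coe _

theorem norm_fourier_apply (n : ℤ) (x : UnitAddCircle) : ‖fourier n x‖ = 1 := by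
  rw [fourier_apply]; exact Circle.norm_coe _

theorem pt_ne_zero (x : UnitAddCircle) : pt x ≠ 0 := by
  rw [← norm_ne_zero_iff, norm_pt]; exact one_ne_zero

theorem conj_pt (x : UnitAddCircle) : conj (pt x) = (pt x)⁻¹ :=
  (Circle.coe_inv_eq_conj _).symm.trans (Circle.coe_inv _)

theorem fourierCoeff_congr {u v : UnitAddCircle → ℂ} (h : ∀ᵐ x ∂arc, u x = v x) (n : ℤ) :
    fourierCoeff u n = fourierCoeff v n :=
  congrFun (fourierCoeff_congr_ae h) n

theorem fourierCoeff_pt_mul (u : UnitAddCircle → ℂ) (n : ℤ) :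
    fourierCoeff (fun x => pt x * u x) n = fourierCoeff u (n - 1) := by
  refine integral_congr_ae (Eventually.of_forall fun x => ?_)
  have : -(n - 1) = -n + 1 := by ring
  simp only [smul_eq_mul, this, fourier_add, pt_eq_fourier, mul_assoc]

theorem fourierCoeff_conj (u : UnitAddCircle → ℂ) (n : ℤ) :
    fourierCoeff (fun x => conj (u x)) n = conj (fourierCoeff u (-n)) := by
  unfold fourierCoeff
  rw [← integral_conj]
  refine integral_congr_ae (Eventually.of_forall fun x => ?_)
  simp only [smul_eq_mul, map_mul, neg_neg, fourier_neg]

theorem fourierCoeff_fun_add {u v : UnitAddCircle → ℂ} (hu : Integrable u arc)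
    (hv : Integrable v arc) (n : ℤ) :
    fourierCoeff (fun x => u x + v x) n = fourierCoeff u n + fourierCoeff v n :=
  congrFun (fourierCoeff.add hu hv) n

theorem fourierCoeff_fun_sub {u v : UnitAddCircle → ℂ} (hu : Integrable u arc)
    (hv : Integrable v arc) (n : ℤ) :
    fourierCoeff (fun x => u x - v x) n = fourierCoeff u n - fourierCoeff v n := by
  have h := fourierCoeff_fun_add hu (hv.const_mul (-1)) n
  rw [fourierCoeff.const_mul] at h
  simpa [sub_eq_add_neg] using h

theorem fourierCoeff_const (c : ℂ) (n : ℤ) :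
    fourierCoeff (fun _ : UnitAddCircle => c) n = if n = 0 then c else 0 := by
  have h := fourierCoeff_fourier 0 n
  have h2 := fourierCoeff.const_mul (fun x : UnitAddCircle => fourier 0 x) c n
  rw [h] at h2
  simpa [eq_comm] using h2

theorem norm_coeffL_one_le (f : LpT 1) (n : ℤ) : ‖coeffL 1 n f‖ ≤ ‖f‖ := by
  rw [L1.norm_eq_integral_norm]
  refine (norm_integral_le_integral_norm _).trans (le_of_eq ?_)
  refine integral_congr_ae (Eventually.of_forall fun x => ?_)
  change ‖fourier (-n) x • f x‖ = ‖f x‖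
  rw [norm_smul, norm_fourier_apply, one_mul]

/-- The Riemann–Lebesgue lemma on the circle. -/
theorem tendsto_fourierCoeff_cofinite {u : UnitAddCircle → ℂ} (hu : Integrable u arc) :
    Tendsto (fourierCoeff u) cofinite (𝓝 0) := by
  -- Trigonometric polynomials have finitely many nonzero coefficients and are dense in `L^1`, where
  -- every coefficient is a functional of norm at most one.
  have hfin : ∀ g ∈ Submodule.span ℂ (Set.range (fourierLp (T := 1) 1)),
      {n : ℤ | coeffL 1 n g ≠ 0}.Finite := by
    intro g hg
    induction hg using Submodule.span_induction with
    | mem x hx =>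
      obtain ⟨m, rfl⟩ := hx
      refine (Set.finite_singleton m).subset fun n hn => ?_
      by_contra hne
      refine hn ?_
      change fourierCoeff _ n = 0
      rw [fourierCoeff_congr_ae (coeFn_fourierLp 1 m)]
      have h := fourierCoeff_fourier m n
      rwa [if_neg (fun h => hne h.symm)] at h
    | zero => simp
    | add x y _ _ hx hy =>
      refine (hx.union hy).subset fun n hn => ?_
      by_contra hcon
      simp only [Set.mem_union, Set.mem_ofPred_eq, not_or, not_not] at hcon
      exact hn (by rw [map_add, hcon.1, hcon.2, add_zero])
    | smul c x _ hx =>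
      refine hx.subset fun n hn hcon => hn (by rw [map_smul, hcon, smul_zero])
  have hu1 : MemLp u 1 arc := memLp_one_iff_integrable.2 hu
  have hcl : hu1.toLp u ∈ closure (Submodule.span ℂ (Set.range (fourierLp (T := 1) 1)) :
      Set (LpT 1)) := by
    rw [← Submodule.topologicalClosure_coe, span_fourierLp_closure_eq_top ENNReal.one_ne_top]
    trivial
  rw [Metric.tendsto_nhds]
  intro ε hε
  obtain ⟨g, hg, hd⟩ := Metric.mem_closure_iff.1 hcl ε hε
  refine (hfin g hg).subset fun n hn hcon => hn ?_
  have h1 : fourierCoeff u n = coeffL 1 n (hu1.toLp u) :=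
    fourierCoeff_congr (MemLp.coeFn_toLp hu1).symm n
  have h2 : coeffL 1 n (hu1.toLp u) = coeffL 1 n (hu1.toLp u - g) := by
    rw [map_sub, hcon, sub_zero]
  change dist _ _ < _
  rw [dist_zero_right, h1, h2]
  rw [dist_eq_norm] at hd
  exact (norm_coeffL_one_le _ n).trans_lt hd

theorem continuous_eq_zero_of_fourierCoeff {φ : UnitAddCircle → ℂ} (hφ : Continuous φ)
    (h : ∀ n, fourierCoeff φ n = 0) (x : UnitAddCircle) : φ x = 0 := by
  have h0 : fourierCoeff (⟨φ, hφ⟩ : C(UnitAddCircle, ℂ)) = 0 := funext h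
  have := has_pointwise_sum_fourier_series_of_summable (f := ⟨φ, hφ⟩)
    (by rw [h0]; exact summable_zero) x
  rw [h0] at this
  simpa using this.unique (by simp)

/-- The correlation `φ t = ∫ u x * w (t + x)` is continuous, since translation is continuous in
`L^{p'}` for `p' < ∞`, and its `n`-th coefficient is the product in the hypothesis. So `φ = 0`, and
the claim is `φ 0 = 0`. This replaces Parseval outside `L^2`. -/
theorem integral_mul_eq_zero_of_fourierCoeff {p p' : ℝ≥0∞} [Fact (1 ≤ p)] [Fact (1 ≤ p')]
    [ENNReal.HolderConjugate p p'] (hp' : p' ≠ ∞) {u w : UnitAddCircle → ℂ}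
    (hu : MemLp u p arc) (hw : MemLp w p' arc)
    (h : ∀ n, fourierCoeff u (-n) * fourierCoeff w n = 0) : ∫ x, u x * w x ∂arc = 0 := by
  have : Fact (p' ≠ ∞) := ⟨hp'⟩
  set φ : UnitAddCircle → ℂ := fun t => ∫ x, u x * w (t + x) ∂arc with hφ
  have hcont : Continuous φ := by
    have h1 : Continuous fun t : UnitAddCircle =>
        (ContinuousLinearMap.mul ℂ ℂ).lpPairing arc p p' (hu.toLp u)
          (DomAddAct.mk t +ᵥ hw.toLp w) := by
      refine (ContinuousLinearMap.continuous _).comp ?_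
      exact (DomAddAct.continuous_mk).vadd continuous_const
    convert h1 using 2 with t
    rw [ContinuousLinearMap.lpPairing_eq_integral, DomAddAct.mk_vadd_toLp]
    refine integral_congr_ae ?_
    filter_upwards [hu.coeFn_toLp, (hw.comp_measurePreserving
      (measurePreserving_vadd t arc)).coeFn_toLp] with x h1 h2
    rw [ContinuousLinearMap.mul_apply', h1]
    exact congrArg (u x * ·) h2.symm
  have hui : Integrable u arc := hu.integrable Fact.out
  have hwi : Integrable w arc := hw.integrable Fact.out
  have hprod : Integrable (fun z : UnitAddCircle × UnitAddCircle => u z.1 * w (z.2 + z.1))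
      (arc.prod arc) :=
    (measurePreserving_prod_add_right arc arc).integrable_comp_of_integrable
      (hui.mul_prod hwi)
  have hz : ∀ n, fourierCoeff φ n = 0 := by
    intro n
    have hint : Integrable (Function.uncurry fun t x : UnitAddCircle =>
        fourier (-n) t * (u x * w (t + x))) (arc.prod arc) := by
      refine Integrable.bdd_mul (c := 1) hprod.swap ?_ ?_
      · exact ((fourier (-n)).continuous.comp continuous_fst).aestronglyMeasurable
      · exact Eventually.of_forall fun z => (norm_fourier_apply _ _).le
    calc fourierCoeff φ n = ∫ t, ∫ x, fourier (-n) t * (u x * w (t + x)) ∂arc ∂arc := by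
          refine integral_congr_ae (Eventually.of_forall fun t => ?_)
          simp only [smul_eq_mul, hφ]
          rw [integral_const_mul]
      _ = ∫ x, ∫ t, fourier (-n) t * (u x * w (t + x)) ∂arc ∂arc := integral_integral_swap hint
      _ = ∫ x, (fourier n x * u x) * fourierCoeff w n ∂arc := by
          refine integral_congr_ae (Eventually.of_forall fun x => ?_)
          simp only
          have hT : fourierCoeff w n = ∫ t, fourier (-n) (t + x) • w (t + x) ∂arc :=
            (integral_add_right_eq_self (μ := arc) (fun t => fourier (-n) t • w t) x).symm
          rw [hT, ← integral_const_mul]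
          refine integral_congr_ae (Eventually.of_forall fun t => ?_)
          have hx : fourier n x * fourier (-n) x = 1 := by
            rw [← fourier_add]; simp
          have ht : (fourier (-n) (t + x) : ℂ) = fourier (-n) t * fourier (-n) x := by
            simp [fourier_apply, AddCircle.toCircle_add]
          simp only [smul_eq_mul, ht]
          linear_combination (-(fourier (-n) t) * u x * w (t + x)) * hx
      _ = fourierCoeff u (-n) * fourierCoeff w n := by
          rw [integral_mul_const]
          simp [fourierCoeff, -fourier_apply]
      _ = 0 := h n
  have := continuous_eq_zero_of_fourierCoeff hcont hz 0
  simpa [hφ] using this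

theorem ae_eq_zero_of_fourierCoeff {p p' : ℝ≥0∞} [Fact (1 ≤ p)] [Fact (1 ≤ p')]
    [ENNReal.HolderConjugate p p'] (hp' : p' ≠ ∞) {u : UnitAddCircle → ℂ}
    (hu : MemLp u p arc) (h : ∀ n, fourierCoeff u n = 0) : ∀ᵐ x ∂arc, u x = 0 := by
  have hui : Integrable u arc := hu.integrable Fact.out
  refine ae_eq_zero_of_forall_setIntegral_eq_of_sigmaFinite (fun s _ _ => hui.integrableOn)
    fun s hs _ => ?_
  -- Testing against indicators reduces uniqueness to vanishing of all set integrals.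
  have hw : MemLp (s.indicator fun _ => (1 : ℂ)) p' arc := (memLp_const (1 : ℂ)).indicator hs
  rw [← integral_mul_eq_zero_of_fourierCoeff hp' hu hw fun n => by rw [h, zero_mul],
    ← integral_indicator hs]
  refine integral_congr_ae (Eventually.of_forall fun x => ?_)
  by_cases hx : x ∈ s <;> simp [hx]

/-! ### Polynomials on the circle -/

/-- Over `ℂ` a nonzero polynomial is a constant times linear factors, so a statement about root
location need only be checked one factor at a time. -/
theorem root_induction {P : ℂ → Prop} {motive : ℂ[X] → Prop}
    (const : ∀ c : ℂ, c ≠ 0 → motive (C c))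
    (linear_mul : ∀ (a : ℂ) (r : ℂ[X]), P a → motive r → motive ((X - C a) * r))
    (r : ℂ[X]) (hr : r ≠ 0) (h : ∀ z, r.IsRoot z → P z) : motive r := by
  induction hn : r.natDegree generalizing r with
  | zero =>
    rw [eq_C_of_natDegree_eq_zero hn] at hr ⊢
    exact const _ (fun h0 => hr (by rw [h0, C_0]))
  | succ n ih =>
    obtain ⟨a, ha⟩ := IsAlgClosed.exists_root r
      (by rw [degree_eq_natDegree hr, hn]; exact_mod_cast n.succ_ne_zero)
    obtain ⟨t, rfl⟩ := dvd_iff_isRoot.2 ha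
    have ht : t ≠ 0 := right_ne_zero_of_mul hr
    refine linear_mul a t (h a ha) (ih t ht (fun z hz => h z (root_mul.2 (Or.inr hz))) ?_)
    rw [natDegree_mul (X_sub_C_ne_zero a) ht, natDegree_X_sub_C] at hn
    omega

theorem continuous_eval_pt (r : ℂ[X]) : Continuous fun x => r.eval (pt x) :=
  r.continuous.comp continuous_pt

theorem eval_pt_ne_zero_of_one_lt {r : ℂ[X]} (hr : ∀ z : ℂ, r.IsRoot z → 1 < ‖z‖)
    (x : UnitAddCircle) : r.eval (pt x) ≠ 0 := fun h => by
  have := hr _ h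
  rw [norm_pt] at this
  exact lt_irrefl _ this

theorem eval_pt_ne_zero_of_lt_one {r : ℂ[X]} (hr : ∀ z : ℂ, r.IsRoot z → ‖z‖ < 1)
    (x : UnitAddCircle) : r.eval (pt x) ≠ 0 := fun h => by
  have := hr _ h
  rw [norm_pt] at this
  exact lt_irrefl _ this

theorem ne_zero_of_roots {r : ℂ[X]} {P : ℂ → Prop} (hr : ∀ z : ℂ, r.IsRoot z → P z) {z : ℂ}
    (hz : ¬ P z) : r ≠ 0 := by
  rintro rfl
  exact hz (hr z (by simp))

theorem sharp_mul (r t : ℂ[X]) : sharp (r * t) = sharp r * sharp t := by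
  rw [sharp, Polynomial.map_mul, reverse_mul_of_domain]; rfl

theorem natDegree_map_conj (r : ℂ[X]) : (r.map (starRingEnd ℂ)).natDegree = r.natDegree :=
  natDegree_map _

theorem conj_eval_eq (r : ℂ[X]) (z : ℂ) :
    (r.map (starRingEnd ℂ)).eval (conj z) = conj (r.eval z) := by
  rw [eval_map, ← eval₂_hom]

theorem sharp_eval_inv_conj_mul (r : ℂ[X]) {z : ℂ} (hz : z ≠ 0) :
    (sharp r).eval z = z ^ r.natDegree * conj (r.eval (conj z)⁻¹) := by
  have hz' : z⁻¹ ≠ 0 := inv_ne_zero hz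
  let : Invertible z⁻¹ := invertibleOfNonzero hz'
  have h := eval₂_reverse_mul_pow (RingHom.id ℂ) z⁻¹ (r.map (starRingEnd ℂ))
  rw [natDegree_map_conj, invOf_eq_inv, inv_inv] at h
  have h2 := conj_eval_eq r (conj z)⁻¹
  rw [map_inv₀, Complex.conj_conj] at h2
  rw [← h2, sharp, ← eval₂_id, ← eval₂_id (p := r.map _) (x := z⁻¹), ← h]
  rw [inv_pow]
  field_simp

theorem sharp_eval_pt (r : ℂ[X]) (x : UnitAddCircle) :
    (sharp r).eval (pt x) = pt x ^ r.natDegree * conj (r.eval (pt x)) := by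
  rw [sharp_eval_inv_conj_mul r (pt_ne_zero x), conj_pt, inv_inv]

theorem one_lt_of_isRoot_sharp {r : ℂ[X]} (hr : ∀ z : ℂ, r.IsRoot z → ‖z‖ < 1) (z : ℂ)
    (hz : (sharp r).IsRoot z) : 1 < ‖z‖ := by
  have hr0 : r ≠ 0 := ne_zero_of_roots hr (z := 1) (by simp)
  have hz0 : z ≠ 0 := by
    rintro rfl
    rw [IsRoot, ← coeff_zero_eq_eval_zero, sharp, coeff_zero_reverse, leadingCoeff_eq_zero] at hz
    exact hr0 ((Polynomial.map_eq_zero _).1 hz)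
  rw [IsRoot, sharp_eval_inv_conj_mul r hz0] at hz
  have h := hr (conj z)⁻¹ (by simpa [hz0] using hz)
  rw [norm_inv, RCLike.norm_conj] at h
  exact (inv_lt_one₀ (norm_pos_iff.2 hz0)).1 h

/-! ### Hardy functions -/

theorem memLp_continuous_mul {p : ℝ≥0∞} {φ u : UnitAddCircle → ℂ} (hφ : Continuous φ)
    (hu : MemLp u p arc) : MemLp (fun x => φ x * u x) p arc := by
  obtain ⟨K, hK⟩ := (isCompact_range hφ).isBounded.exists_norm_le
  have hφ' : MemLp φ ∞ arc := memLp_top_of_bound hφ.aestronglyMeasurable K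
    (Eventually.of_forall fun x => hK _ (Set.mem_range_self x))
  exact hu.mul (p := ∞) (q := p) hφ'

theorem memLp_continuous {p : ℝ≥0∞} {φ : UnitAddCircle → ℂ} (hφ : Continuous φ) :
    MemLp φ p arc := by
  simpa using memLp_continuous_mul hφ (memLp_const (p := p) (1 : ℂ))

theorem memLp_conj {p : ℝ≥0∞} {u : UnitAddCircle → ℂ} (hu : MemLp u p arc) :
    MemLp (fun x => conj (u x)) p arc := hu.star

/-- Functions in `L^p` whose Fourier coefficients of negative index vanish. -/
def MemHardy (p : ℝ≥0∞) (u : UnitAddCircle → ℂ) : Prop :=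
  MemLp u p arc ∧ ∀ n : ℤ, n < 0 → fourierCoeff u n = 0

/-- Functions in `L^p` whose Fourier coefficients of nonnegative index vanish. -/
def MemCoHardy (p : ℝ≥0∞) (u : UnitAddCircle → ℂ) : Prop :=
  MemLp u p arc ∧ ∀ n : ℤ, 0 ≤ n → fourierCoeff u n = 0

/-- Functions in `L^p` that are the sum of a function in `H^p` and one with only Fourier
coefficients of negative index. -/
def HasRieszProj (p : ℝ≥0∞) (u : UnitAddCircle → ℂ) : Prop :=
  ∃ h, MemHardy p h ∧ MemCoHardy p (fun x => u x - h x)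

section HardyFunctions

variable {p : ℝ≥0∞} [Fact (1 ≤ p)] {u v : UnitAddCircle → ℂ}

theorem MemHardy.integrable (hu : MemHardy p u) : Integrable u arc := hu.1.integrable Fact.out

theorem MemCoHardy.integrable (hu : MemCoHardy p u) : Integrable u arc := hu.1.integrable Fact.out

omit [Fact (1 ≤ p)] in
theorem MemHardy.congr (hu : MemHardy p u) (h : ∀ᵐ x ∂arc, u x = v x) : MemHardy p v :=
  ⟨hu.1.ae_eq h, fun n hn => by rw [← fourierCoeff_congr h, hu.2 n hn]⟩

omit [Fact (1 ≤ p)] in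
theorem MemCoHardy.congr (hu : MemCoHardy p u) (h : ∀ᵐ x ∂arc, u x = v x) : MemCoHardy p v :=
  ⟨hu.1.ae_eq h, fun n hn => by rw [← fourierCoeff_congr h, hu.2 n hn]⟩

theorem MemHardy.add (hu : MemHardy p u) (hv : MemHardy p v) :
    MemHardy p (fun x => u x + v x) :=
  ⟨hu.1.add hv.1, fun n hn => by
    rw [fourierCoeff_fun_add hu.integrable hv.integrable, hu.2 n hn, hv.2 n hn, add_zero]⟩

theorem MemHardy.sub (hu : MemHardy p u) (hv : MemHardy p v) :
    MemHardy p (fun x => u x - v x) :=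
  ⟨hu.1.sub hv.1, fun n hn => by
    rw [fourierCoeff_fun_sub hu.integrable hv.integrable, hu.2 n hn, hv.2 n hn, sub_zero]⟩

theorem MemCoHardy.add (hu : MemCoHardy p u) (hv : MemCoHardy p v) :
    MemCoHardy p (fun x => u x + v x) :=
  ⟨hu.1.add hv.1, fun n hn => by
    rw [fourierCoeff_fun_add hu.integrable hv.integrable, hu.2 n hn, hv.2 n hn, add_zero]⟩

theorem MemCoHardy.sub (hu : MemCoHardy p u) (hv : MemCoHardy p v) :
    MemCoHardy p (fun x => u x - v x) :=
  ⟨hu.1.sub hv.1, fun n hn => by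
    rw [fourierCoeff_fun_sub hu.integrable hv.integrable, hu.2 n hn, hv.2 n hn, sub_zero]⟩

omit [Fact (1 ≤ p)] in
theorem MemHardy.const_mul (c : ℂ) (hu : MemHardy p u) : MemHardy p (fun x => c * u x) :=
  ⟨hu.1.const_mul c, fun n hn => by rw [fourierCoeff.const_mul, hu.2 n hn, mul_zero]⟩

omit [Fact (1 ≤ p)] in
theorem MemCoHardy.const_mul (c : ℂ) (hu : MemCoHardy p u) : MemCoHardy p (fun x => c * u x) :=
  ⟨hu.1.const_mul c, fun n hn => by rw [fourierCoeff.const_mul, hu.2 n hn, mul_zero]⟩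

omit [Fact (1 ≤ p)] in
theorem memHardy_const (c : ℂ) : MemHardy p (fun _ => c) :=
  ⟨memLp_const c, fun n hn => by rw [fourierCoeff_const, if_neg hn.ne]⟩

omit [Fact (1 ≤ p)] in
theorem MemHardy.pt_mul (hu : MemHardy p u) : MemHardy p (fun x => pt x * u x) :=
  ⟨memLp_continuous_mul continuous_pt hu.1, fun n hn => by
    rw [fourierCoeff_pt_mul, hu.2 _ (by omega)]⟩

theorem MemHardy.eval_mul (r : ℂ[X]) (hu : MemHardy p u) :
    MemHardy p (fun x => r.eval (pt x) * u x) := by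
  induction r using Polynomial.induction_on with
  | C a => simpa using hu.const_mul a
  | add r t hr ht => simpa [add_mul] using hr.add ht
  | monomial n a h =>
    refine h.pt_mul.congr (Eventually.of_forall fun x => ?_)
    simp only [Polynomial.eval_mul, eval_C, eval_pow, eval_X]
    ring

theorem memHardy_eval (r : ℂ[X]) : MemHardy p (fun x => r.eval (pt x)) := by
  simpa using (memHardy_const (p := p) 1).eval_mul r

theorem fourierCoeff_linear_mul (a : ℂ) (hu : Integrable u arc) (n : ℤ) :
    fourierCoeff (fun x => (pt x - a) * u x) n = fourierCoeff u (n - 1) - a * fourierCoeff u n := by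
  simp only [sub_mul]
  rw [fourierCoeff_fun_sub (u := fun x => pt x * u x) (v := fun x => a * u x) ?_
    (hu.const_mul a), fourierCoeff_pt_mul, fourierCoeff.const_mul]
  exact memLp_one_iff_integrable.1
    (memLp_continuous_mul continuous_pt (memLp_one_iff_integrable.2 hu))

/-- Riemann–Lebesgue: the coefficients along an injective sequence of indices tend to zero. -/
theorem fourierCoeff_eq_zero_of_le (hu : Integrable u arc) (n : ℤ) (f : ℕ → ℤ)
    (hf : Function.Injective f) (h : ∀ j, ‖fourierCoeff u n‖ ≤ ‖fourierCoeff u (f j)‖) :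
    fourierCoeff u n = 0 := by
  have h1 : Tendsto (fun j => ‖fourierCoeff u (f j)‖) atTop (𝓝 0) := by
    rw [← Nat.cofinite_eq_atTop]
    simpa using ((tendsto_fourierCoeff_cofinite hu).comp hf.tendsto_cofinite).norm
  exact norm_le_zero_iff.1 (ge_of_tendsto' h1 h)

/-- Vanishing of the coefficients before `N` passes through a factor `z - a` with `1 ≤ |a|`. -/
theorem fourierCoeff_eq_zero_of_linear_mul {a : ℂ} (ha : 1 ≤ ‖a‖) (hu : Integrable u arc)
    {N : ℤ} (h : ∀ n < N, fourierCoeff (fun x => (pt x - a) * u x) n = 0) (n : ℤ) (hn : n < N) :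
    fourierCoeff u n = 0 := by
  refine fourierCoeff_eq_zero_of_le hu n (fun j => n - j) (fun i j hij => by simpa using hij) ?_
  intro j
  induction j with
  | zero => simp
  | succ j ih =>
    refine ih.trans ?_
    have h1 := h (n - j) (by omega)
    rw [fourierCoeff_linear_mul a hu, sub_eq_zero] at h1
    have h2 : n - ((j + 1 : ℕ) : ℤ) = n - j - 1 := by push_cast; ring
    simp only [h2, h1, norm_mul]
    exact le_mul_of_one_le_left (norm_nonneg _) ha

theorem MemHardy.of_eval_mul {r : ℂ[X]} (hr : ∀ z : ℂ, r.IsRoot z → 1 ≤ ‖z‖)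
    (hu : MemLp u p arc) (h : MemHardy p (fun x => r.eval (pt x) * u x)) : MemHardy p u := by
  have hr0 : r ≠ 0 := ne_zero_of_roots hr (z := 0) (by simp)
  refine root_induction (P := fun z => 1 ≤ ‖z‖) (motive := fun r =>
    MemHardy p (fun x => r.eval (pt x) * u x) → MemHardy p u) ?_ ?_ r hr0 hr h
  · intro c hc h
    refine (h.const_mul c⁻¹).congr (Eventually.of_forall fun x => ?_)
    simp [hc]
  · intro a r ha ih h
    have hm : MemLp (fun x => r.eval (pt x) * u x) p arc :=
      memLp_continuous_mul (continuous_eval_pt r) hu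
    refine ih ⟨hm, fourierCoeff_eq_zero_of_linear_mul ha (hm.integrable Fact.out) fun n hn => ?_⟩
    rw [← h.2 n hn]
    simp only [Polynomial.eval_mul, eval_sub, eval_X, eval_C, mul_assoc]

omit [Fact (1 ≤ p)] in
theorem memLp_div_eval {r : ℂ[X]} (hr : ∀ x, r.eval (pt x) ≠ 0) (hu : MemLp u p arc) :
    MemLp (fun x => u x / r.eval (pt x)) p arc := by
  simp only [div_eq_inv_mul]
  exact memLp_continuous_mul ((continuous_eval_pt r).inv₀ hr) hu

theorem MemHardy.div_eval {r : ℂ[X]} (hr : ∀ z : ℂ, r.IsRoot z → 1 < ‖z‖) (hu : MemHardy p u) :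
    MemHardy p (fun x => u x / r.eval (pt x)) := by
  refine MemHardy.of_eval_mul (fun z hz => (hr z hz).le)
    (memLp_div_eval (eval_pt_ne_zero_of_one_lt hr) hu.1) (hu.congr (Eventually.of_forall fun x => ?_))
  rw [mul_div_cancel₀ _ (eval_pt_ne_zero_of_one_lt hr x)]

omit [Fact (1 ≤ p)] in
-- Conjugation sends index `n` to `-n`; the extra factor `z` compensates for index `0` counting as
-- Hardy. Results for `H^p` thus transfer to co-Hardy functions.
theorem memCoHardy_iff : MemCoHardy p u ↔ MemHardy p (fun x => conj (pt x * u x)) := by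
  have hc : ∀ n, fourierCoeff (fun x => conj (pt x * u x)) n = conj (fourierCoeff u (-n - 1)) :=
    fun n => by rw [fourierCoeff_conj (fun x => pt x * u x), fourierCoeff_pt_mul]
  constructor
  · rintro ⟨h1, h2⟩
    exact ⟨memLp_conj (memLp_continuous_mul continuous_pt h1), fun n hn => by
      rw [hc, h2 _ (by omega), map_zero]⟩
  · rintro ⟨h1, h2⟩
    refine ⟨?_, fun n hn => ?_⟩
    · refine (memLp_conj (memLp_continuous_mul continuous_pt h1)).ae_eq
        (Eventually.of_forall fun x => ?_)
      simp only [map_mul, Complex.conj_conj]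
      rw [conj_pt, inv_mul_cancel_left₀ (pt_ne_zero x)]
    · have := h2 (-n - 1) (by omega)
      rw [hc] at this
      simpa using this

theorem MemCoHardy.conj_eval_mul (r : ℂ[X]) (hu : MemCoHardy p u) :
    MemCoHardy p (fun x => conj (r.eval (pt x)) * u x) := by
  rw [memCoHardy_iff] at hu ⊢
  refine (hu.eval_mul r).congr (Eventually.of_forall fun x => ?_)
  simp only [map_mul, Complex.conj_conj]
  ring

theorem MemCoHardy.of_conj_eval_mul {r : ℂ[X]} (hr : ∀ z : ℂ, r.IsRoot z → 1 ≤ ‖z‖)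
    (hu : MemLp u p arc) (h : MemCoHardy p (fun x => conj (r.eval (pt x)) * u x)) :
    MemCoHardy p u := by
  rw [memCoHardy_iff] at h ⊢
  refine MemHardy.of_eval_mul hr (memLp_conj (memLp_continuous_mul continuous_pt hu))
    (h.congr (Eventually.of_forall fun x => ?_))
  simp only [map_mul, Complex.conj_conj]
  ring

omit [Fact (1 ≤ p)] in
theorem memLp_div_conj_eval {r : ℂ[X]} (hr : ∀ x, r.eval (pt x) ≠ 0) (hu : MemLp u p arc) :
    MemLp (fun x => u x / conj (r.eval (pt x))) p arc := by
  simpa using memLp_conj (memLp_div_eval hr (memLp_conj hu))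

theorem MemCoHardy.div_conj_eval {r : ℂ[X]} (hr : ∀ z : ℂ, r.IsRoot z → 1 < ‖z‖)
    (hu : MemCoHardy p u) : MemCoHardy p (fun x => u x / conj (r.eval (pt x))) := by
  refine MemCoHardy.of_conj_eval_mul (fun z hz => (hr z hz).le)
    (memLp_div_conj_eval (eval_pt_ne_zero_of_one_lt hr) hu.1)
    (hu.congr (Eventually.of_forall fun x => ?_))
  rw [mul_div_cancel₀ _ (by simpa using eval_pt_ne_zero_of_one_lt hr x)]

omit [Fact (1 ≤ p)] in
theorem memCoHardy_conj_pt : MemCoHardy p (fun x => conj (pt x)) := by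
  rw [memCoHardy_iff]
  refine (memHardy_const 1).congr (Eventually.of_forall fun x => ?_)
  simp [conj_pt, pt_ne_zero]

theorem MemCoHardy.conj_pt_mul (hu : MemCoHardy p u) : MemCoHardy p (fun x => conj (pt x) * u x) := by
  simpa using hu.conj_eval_mul X

theorem fourierCoeff_conj_pt_mul (u : UnitAddCircle → ℂ) (n : ℤ) :
    fourierCoeff (fun x => conj (pt x) * u x) n = fourierCoeff u (n + 1) := by
  have h := fourierCoeff_pt_mul (fun x => conj (pt x) * u x) (n + 1)
  rw [add_sub_cancel_right] at h
  rw [← h]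
  refine fourierCoeff_congr (Eventually.of_forall fun x => ?_) _
  rw [conj_pt, ← mul_assoc, mul_inv_cancel₀ (pt_ne_zero x), one_mul]

theorem fourierCoeff_conj_linear_mul (a : ℂ) (hu : Integrable u arc) (n : ℤ) :
    fourierCoeff (fun x => conj (pt x - a) * u x) n
      = fourierCoeff u (n + 1) - conj a * fourierCoeff u n := by
  simp only [map_sub, sub_mul]
  rw [fourierCoeff_fun_sub (u := fun x => conj (pt x) * u x) (v := fun x => conj a * u x) ?_
    (hu.const_mul _), fourierCoeff_conj_pt_mul, fourierCoeff.const_mul]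
  exact memLp_one_iff_integrable.1
    (memLp_continuous_mul (Complex.continuous_conj.comp continuous_pt)
      (memLp_one_iff_integrable.2 hu))

/-! ### Existence of Riesz projections -/

omit [Fact (1 ≤ p)] in
theorem MemHardy.hasRieszProj (hu : MemHardy p u) : HasRieszProj p u :=
  ⟨u, hu, by simp [MemCoHardy, fourierCoeff]⟩

omit [Fact (1 ≤ p)] in
theorem MemCoHardy.hasRieszProj (hu : MemCoHardy p u) : HasRieszProj p u :=
  ⟨fun _ => 0, memHardy_const 0, by simpa using hu⟩

omit [Fact (1 ≤ p)] in
theorem HasRieszProj.congr (hu : HasRieszProj p u) (h : ∀ᵐ x ∂arc, u x = v x) :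
    HasRieszProj p v := by
  obtain ⟨k, h1, h2⟩ := hu
  exact ⟨k, h1, h2.congr (h.mono fun x hx => by rw [hx])⟩

theorem HasRieszProj.add (hu : HasRieszProj p u) (hv : HasRieszProj p v) :
    HasRieszProj p (fun x => u x + v x) := by
  obtain ⟨k, h1, h2⟩ := hu
  obtain ⟨l, h3, h4⟩ := hv
  exact ⟨_, h1.add h3, (h2.add h4).congr (Eventually.of_forall fun x => by ring)⟩

omit [Fact (1 ≤ p)] in
theorem HasRieszProj.const_mul (c : ℂ) (hu : HasRieszProj p u) :
    HasRieszProj p (fun x => c * u x) := by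
  obtain ⟨k, h1, h2⟩ := hu
  exact ⟨_, h1.const_mul c, (h2.const_mul c).congr (Eventually.of_forall fun x => by ring)⟩

theorem HasRieszProj.conj_pt_mul (hu : HasRieszProj p u) :
    HasRieszProj p (fun x => conj (pt x) * u x) := by
  obtain ⟨h, h1, h2⟩ := hu
  -- The backward shift moves this one coefficient to index `-1`, hence into the co-Hardy part.
  set c := fourierCoeff h 0
  have hH : MemHardy p (fun x => conj (pt x) * (h x - c)) := by
    have h3 := h1.sub (memHardy_const c)
    refine ⟨memLp_continuous_mul (Complex.continuous_conj.comp continuous_pt) h3.1,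
      fun n hn => ?_⟩
    rw [fourierCoeff_conj_pt_mul (fun x => h x - c)]
    rcases (show n + 1 ≤ 0 by omega).lt_or_eq with h0 | h0
    · exact h3.2 _ h0
    · rw [fourierCoeff_fun_sub h1.integrable (integrable_const c), h0, fourierCoeff_const]
      simp [c]
  have hN := (h2.conj_pt_mul.add ((memCoHardy_conj_pt (p := p)).const_mul c)).hasRieszProj
  exact (hH.hasRieszProj.add hN).congr (Eventually.of_forall fun x => by ring)

theorem HasRieszProj.conj_eval_mul (r : ℂ[X]) (hu : HasRieszProj p u) :
    HasRieszProj p (fun x => conj (r.eval (pt x)) * u x) := by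
  induction r using Polynomial.induction_on with
  | C a => simpa using hu.const_mul (conj a)
  | add r t hr ht => simpa [add_mul] using hr.add ht
  | monomial n a h =>
    refine h.conj_pt_mul.congr (Eventually.of_forall fun x => ?_)
    simp only [Polynomial.eval_mul, eval_C, eval_pow, eval_X, map_mul, map_pow]
    ring

/-- The quotient `y` is split explicitly as `(y - c w + c) + c (w - 1)`, with `w - 1` co-Hardy and
`y - c w` Hardy. -/
theorem MemHardy.hasRieszProj_div_conj_linear {a : ℂ} (ha : 1 < ‖a‖) (hu : MemHardy p u) :
    HasRieszProj p (fun x => u x / conj (pt x - a)) := by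
  have hroot : ∀ z : ℂ, (X - C a).IsRoot z → 1 < ‖z‖ := fun z hz => by
    rw [root_X_sub_C.1 hz.eq_zero] at ha; exact ha
  have hne : ∀ x, pt x - a ≠ 0 := fun x => by simpa using eval_pt_ne_zero_of_one_lt hroot x
  have hne' : ∀ x, conj (pt x - a) ≠ 0 := fun x =>
    (_root_.map_ne_zero _).2 (hne x)
  have ha0 : conj a ≠ 0 := by
    rw [← norm_ne_zero_iff, RCLike.norm_conj]; linarith
  have hnx : ∀ x, (X - C a).eval (pt x) ≠ 0 := eval_pt_ne_zero_of_one_lt hroot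
  have hy : MemLp (fun x => u x / conj (pt x - a)) p arc := by
    simpa using memLp_div_conj_eval hnx hu.1
  set y := fun x => u x / conj (pt x - a) with hydef
  have hyI : Integrable y arc := hy.integrable Fact.out
  -- the coefficients of `w` are those of the geometric series of `1 / (1 - conj z / conj a)`
  set w := fun x : UnitAddCircle => -conj a / conj (pt x - a) with hwdef
  have hw : MemLp w p arc := by
    simpa [hwdef] using memLp_div_conj_eval hnx (memLp_const (p := p) (-conj a))
  have hw1 : MemCoHardy p (fun x => w x - 1) := by
    refine MemCoHardy.of_conj_eval_mul (fun z hz => (hroot z hz).le) (hw.sub (memLp_const 1)) ?_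
    refine ((memCoHardy_conj_pt (p := p)).const_mul (-1)).congr (Eventually.of_forall fun x => ?_)
    have h1 : conj (pt x - a) * w x = -conj a := mul_div_cancel₀ _ (hne' x)
    rw [eval_sub, eval_X, eval_C, mul_sub, h1, map_sub]
    ring
  -- Makes the coefficient of `y - c w` at index `0` vanish; the recursion `hrec` then carries this
  -- zero to all negative indices.
  set c := fourierCoeff y 0
  have hwI : Integrable w arc := hw.integrable Fact.out
  have hw0 : fourierCoeff w 0 = 1 := by
    have := hw1.2 0 le_rfl
    rw [fourierCoeff_fun_sub hwI (integrable_const 1), fourierCoeff_const, if_pos rfl,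
      sub_eq_zero] at this
    exact this
  have hYm : MemLp (fun x => y x - c * w x) p arc := hy.sub (hw.const_mul c)
  have hY : MemHardy p (fun x => y x - c * w x) := by
    refine ⟨hYm, ?_⟩
    have hYI : Integrable (fun x => y x - c * w x) arc := hYm.integrable Fact.out
    have hrec : ∀ n < 0, fourierCoeff (fun x => y x - c * w x) (n + 1)
        = conj a * fourierCoeff (fun x => y x - c * w x) n := by
      intro n hn
      rw [← sub_eq_zero, ← fourierCoeff_conj_linear_mul a hYI]
      have h3 : ∀ x, conj (pt x - a) * (y x - c * w x) = u x + c * conj a := fun x => by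
        have h1 : conj (pt x - a) * w x = -conj a := mul_div_cancel₀ _ (hne' x)
        have h2 : conj (pt x - a) * y x = u x := mul_div_cancel₀ _ (hne' x)
        linear_combination h2 - c * h1
      simp only [h3]
      exact (hu.add (memHardy_const _)).2 n hn
    have hzero : ∀ j : ℕ, fourierCoeff (fun x => y x - c * w x) (-j) = 0 := by
      intro j
      induction j with
      | zero =>
        simp only [Nat.cast_zero, neg_zero]
        rw [fourierCoeff_fun_sub hyI (hwI.const_mul c), fourierCoeff.const_mul, hw0]
        simp [c]
      | succ j ih =>
        have h4 := hrec (-((j + 1 : ℕ) : ℤ)) (by push_cast; omega)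
        rw [show -((j + 1 : ℕ) : ℤ) + 1 = -j by push_cast; ring, ih] at h4
        exact (mul_eq_zero.1 h4.symm).resolve_left ha0
    intro n hn
    obtain ⟨j, rfl⟩ : ∃ j : ℕ, n = -j := ⟨n.natAbs, by omega⟩
    exact hzero j
  refine ((hY.add (memHardy_const c)).hasRieszProj.add (hw1.const_mul c).hasRieszProj).congr
    (Eventually.of_forall fun x => by ring)

theorem HasRieszProj.div_conj_eval {r : ℂ[X]} (hr : ∀ z : ℂ, r.IsRoot z → 1 < ‖z‖)
    (hu : HasRieszProj p u) : HasRieszProj p (fun x => u x / conj (r.eval (pt x))) := by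
  have hr0 : r ≠ 0 := ne_zero_of_roots hr (z := 0) (by simp)
  refine root_induction (P := fun z => 1 < ‖z‖) (motive := fun r =>
    HasRieszProj p (fun x => u x / conj (r.eval (pt x)))) ?_ ?_ r hr0 hr
  · intro c hc
    simpa [div_eq_inv_mul] using hu.const_mul (conj c)⁻¹
  · rintro a r ha ⟨h, h1, h2⟩
    have hroot : ∀ z : ℂ, (X - C a).IsRoot z → 1 < ‖z‖ := fun z hz => by
      rw [root_X_sub_C.1 hz.eq_zero] at ha; exact ha
    -- The co-Hardy part stays co-Hardy under this division, so only the Hardy part needs a new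
    -- splitting.
    refine ((h1.hasRieszProj_div_conj_linear ha).add
      (h2.div_conj_eval hroot).hasRieszProj).congr (Eventually.of_forall fun x => ?_)
    simp only [Polynomial.eval_mul, eval_sub, eval_X, eval_C, map_mul]
    rw [← add_div, mul_comm, ← div_div]
    ring

/-! ### Uniqueness and orthogonality -/

theorem MemHardy.ae_eq_zero (hp : 1 < p) (hu : MemHardy p u) (hu' : MemCoHardy p u) :
    ∀ᵐ x ∂arc, u x = 0 := by
  have hc : ENNReal.HolderConjugate p p.conjExponent := inferInstance
  have : Fact (1 ≤ p.conjExponent) := ⟨ENNReal.HolderConjugate.one_le _ p⟩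
  refine ae_eq_zero_of_fourierCoeff (p' := p.conjExponent) ?_ hu.1 fun n => ?_
  · exact (ENNReal.HolderConjugate.ne_top_iff_ne_one _ p).2 hp.ne'
  · rcases lt_or_ge n 0 with h | h
    · exact hu.2 n h
    · exact hu'.2 n h

theorem integral_conj_mul_eq_zero {p' : ℝ≥0∞} [Fact (1 ≤ p')] [ENNReal.HolderConjugate p p']
    (hp' : p' ≠ ∞) {g : UnitAddCircle → ℂ} (hu : MemCoHardy p u) (hg : MemHardy p' g) :
    ∫ x, conj (g x) * u x ∂arc = 0 := by
  simp only [mul_comm (conj _)]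
  refine integral_mul_eq_zero_of_fourierCoeff (p := p) (p' := p') hp' hu.1 (memLp_conj hg.1)
    fun n => ?_
  rw [fourierCoeff_conj]
  rcases lt_or_ge (-n) 0 with h | h
  · rw [hg.2 _ h, map_zero, mul_zero]
  · rw [hu.2 _ h, zero_mul]

end HardyFunctions

/-! ### Hardy functions as elements of `H^p` -/

section Bridge

variable {p : ℝ≥0∞} [Fact (1 ≤ p)] {u v : UnitAddCircle → ℂ}

theorem memHardy_coe (g : Hardy p) : MemHardy p (g : LpT p) := ⟨Lp.memLp _, g.2⟩

/-- The element of `H^p` represented by a Hardy function. -/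
noncomputable def MemHardy.toHardy (hu : MemHardy p u) : Hardy p :=
  ⟨hu.1.toLp u, fun n hn => (fourierCoeff_congr hu.1.coeFn_toLp n).trans (hu.2 n hn)⟩

theorem MemHardy.coe_toHardy (hu : MemHardy p u) :
    ∀ᵐ x ∂arc, (hu.toHardy : LpT p) x = u x := hu.1.coeFn_toLp

theorem hardy_ext {g h : Hardy p} (H : ∀ᵐ x ∂arc, (g : LpT p) x = (h : LpT p) x) : g = h :=
  Subtype.ext (Lp.ext H)

theorem hardy_coe_add (g h : Hardy p) :
    ∀ᵐ x ∂arc, ((g + h : Hardy p) : LpT p) x = (g : LpT p) x + (h : LpT p) x :=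
  Lp.coeFn_add (g : LpT p) (h : LpT p)

theorem hardy_coe_sub (g h : Hardy p) :
    ∀ᵐ x ∂arc, ((g - h : Hardy p) : LpT p) x = (g : LpT p) x - (h : LpT p) x :=
  Lp.coeFn_sub (g : LpT p) (h : LpT p)

theorem hardy_coe_smul (c : ℂ) (g : Hardy p) :
    ∀ᵐ x ∂arc, ((c • g : Hardy p) : LpT p) x = c * (g : LpT p) x :=
  Lp.coeFn_smul c (g : LpT p)

theorem hardy_coe_zero : ∀ᵐ x ∂arc, ((0 : Hardy p) : LpT p) x = 0 :=
  Lp.coeFn_zero ℂ p arc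

theorem isRieszProj_iff (f : LpT p) (h : Hardy p) :
    IsRieszProj f h ↔ MemCoHardy p (fun x => f x - (h : LpT p) x) := by
  have hc : ∀ n, fourierCoeff (fun x => f x - (h : LpT p) x) n
      = coeffL p n f - coeffL p n (h : LpT p) :=
    fun n => fourierCoeff_fun_sub (integrable_LpT f) (integrable_LpT _) n
  refine ⟨fun H => ⟨(Lp.memLp f).sub (Lp.memLp _), fun n hn => ?_⟩, fun H n hn => ?_⟩
  · rw [hc, H n hn, sub_self]
  · exact (sub_eq_zero.1 ((hc n).symm.trans (H.2 n hn))).symm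

theorem mem_toeplitz_iff {φ : UnitAddCircle → ℂ} {g k : Hardy p} :
    (g, k) ∈ toeplitz p φ ↔ ∃ ρ : RatFunc ℂ, IsRatZero ρ ∧
      MemCoHardy p (fun x => φ x * (g : LpT p) x - onCircle ρ x - (k : LpT p) x) := by
  constructor
  · rintro ⟨f, ρ, hρ, he, hP⟩
    refine ⟨ρ, hρ, ((isRieszProj_iff f k).1 hP).congr ?_⟩
    filter_upwards [he] with x hx
    rw [hx]; ring
  · rintro ⟨ρ, hρ, h⟩
    have hm : MemLp (fun x => φ x * (g : LpT p) x - onCircle ρ x) p arc :=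
      (h.1.add (Lp.memLp (k : LpT p))).ae_eq (Eventually.of_forall fun x => by simp)
    refine ⟨hm.toLp _, ρ, hρ, ?_, (isRieszProj_iff _ _).2 (h.congr ?_)⟩
    · filter_upwards [hm.coeFn_toLp] with x hx
      rw [hx]; ring
    · filter_upwards [hm.coeFn_toLp] with x hx
      rw [hx]

theorem onCircle_zero (x : UnitAddCircle) : onCircle 0 x = 0 := by simp [onCircle]

theorem mem_toeplitz_of_memCoHardy {φ : UnitAddCircle → ℂ} {g k : Hardy p}
    (h : MemCoHardy p (fun x => φ x * (g : LpT p) x - (k : LpT p) x)) : (g, k) ∈ toeplitz p φ :=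
  mem_toeplitz_iff.2 ⟨0, isRatZero_zero, by simpa only [onCircle_zero, sub_zero] using h⟩

end Bridge

/-! ### Rational functions with poles on the circle -/

theorem onCircle_div (a : ℂ[X]) {b : ℂ[X]} (hb : b ≠ 0) :
    ∀ᵐ x ∂arc, onCircle (algebraMap ℂ[X] (RatFunc ℂ) a / algebraMap ℂ[X] (RatFunc ℂ) b) x
      = a.eval (pt x) / b.eval (pt x) := by
  set ρ := algebraMap ℂ[X] (RatFunc ℂ) a / algebraMap ℂ[X] (RatFunc ℂ) b with hρ
  have h : ρ.num * b = a * ρ.denom := (RatFunc.num_mul_eq_mul_denom_iff hb).2 hρ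
  filter_upwards [ae_eval_ne_zero hb, ae_eval_ne_zero ρ.denom_ne_zero] with x h1 h2
  have h3 := congrArg (Polynomial.eval (pt x)) h
  rw [eval_mul, eval_mul] at h3
  change ρ.num.eval (pt x) / ρ.denom.eval (pt x) = _
  rw [div_eq_div_iff h2 h1, h3]

theorem onCircle_eq (ρ : RatFunc ℂ) (x : UnitAddCircle) :
    onCircle ρ x = ρ.num.eval (pt x) / ρ.denom.eval (pt x) := rfl

theorem isRatZero_div {a b : ℂ[X]} (hab : a.degree < b.degree)
    (hb : ∀ z : ℂ, b.IsRoot z → ‖z‖ = 1) :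
    IsRatZero (algebraMap ℂ[X] (RatFunc ℂ) a / algebraMap ℂ[X] (RatFunc ℂ) b) := by
  have hb0 : b ≠ 0 := ne_zero_of_roots hb (z := 0) (by simp)
  set ρ := algebraMap ℂ[X] (RatFunc ℂ) a / algebraMap ℂ[X] (RatFunc ℂ) b with hρ
  refine ⟨?_, fun z hz => hb z (hz.dvd (RatFunc.denom_div_dvd a b))⟩
  have h : ρ.num * b = a * ρ.denom := (RatFunc.num_mul_eq_mul_denom_iff hb0).2 hρ
  have h2 := congrArg degree h
  rw [degree_mul, degree_mul] at h2
  by_contra hcon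
  rw [not_lt] at hcon
  have h3 : a.degree + ρ.denom.degree < b.degree + ρ.denom.degree :=
    WithBot.add_lt_add_right (mt degree_eq_bot.1 ρ.denom_ne_zero) hab
  rw [← h2, add_comm] at h3
  exact absurd h3 (not_lt.2 (by gcongr))

/-- A rational function with poles only on the circle that is integrable there has no poles. -/
theorem denom_eq_one_of_integrable {ρ : RatFunc ℂ} (hρ : ∀ z : ℂ, ρ.denom.IsRoot z → ‖z‖ = 1)
    (h : Integrable (onCircle ρ) arc) : ρ.denom = 1 := by
  by_contra hne
  obtain ⟨a, ha⟩ := IsAlgClosed.exists_root ρ.denom fun h0 =>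
    hne (ρ.monic_denom.natDegree_eq_zero.1 (natDegree_eq_of_degree_eq_some h0))
  have hnorm := hρ a ha
  obtain ⟨D, hD⟩ := dvd_iff_isRoot.2 ha
  have hc : ρ.num.eval a ≠ 0 := fun h0 => by
    obtain ⟨s, t, hst⟩ := ρ.isCoprime_num_denom
    have := congrArg (Polynomial.eval a) hst
    rw [eval_add, eval_mul, eval_mul, h0, ha.eq_zero] at this
    simp at this
  set c := ρ.num.eval a with hcdef
  obtain ⟨e, he⟩ : X - C a ∣ ρ.num - C c := by
    rw [dvd_iff_isRoot]; simp [hcdef]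
  -- `Y` is `c / (z - a)` almost everywhere: the simple pole left once `D` has removed the rest of
  -- the denominator and `e` the regular part. As `|a| = 1`, its coefficients have constant modulus
  -- on either side of the jump `c` at index `0`, so integrability forces `c = 0`.
  set Y : UnitAddCircle → ℂ := fun x => D.eval (pt x) * onCircle ρ x - e.eval (pt x) with hY
  have hYI : Integrable Y arc := memLp_one_iff_integrable.1
    ((memLp_continuous_mul (continuous_eval_pt D) (memLp_one_iff_integrable.2 h)).sub
      (memLp_continuous (continuous_eval_pt e)))
  have hmul : ∀ᵐ x ∂arc, (pt x - a) * Y x = c := by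
    filter_upwards [ae_eval_ne_zero ρ.denom_ne_zero] with x hx
    have h1 := congrArg (Polynomial.eval (pt x)) hD
    have h2 := congrArg (Polynomial.eval (pt x)) he
    simp only [eval_mul, eval_sub, eval_X, eval_C] at h1 h2
    have h3 : ρ.denom.eval (pt x) * onCircle ρ x = ρ.num.eval (pt x) := mul_div_cancel₀ _ hx
    simp only [hY]
    linear_combination h3 - onCircle ρ x * h1 + h2
  have hrec : ∀ n, fourierCoeff Y (n - 1) - a * fourierCoeff Y n = if n = 0 then c else 0 :=
    fun n => by
      rw [← fourierCoeff_linear_mul a hYI, fourierCoeff_congr hmul, fourierCoeff_const]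
  have hneg : ∀ n < 0, fourierCoeff Y n = 0 :=
    fourierCoeff_eq_zero_of_linear_mul hnorm.ge hYI fun n hn => by
      rw [fourierCoeff_linear_mul a hYI, hrec, if_neg hn.ne]
  have h0 : fourierCoeff Y 0 = 0 := by
    refine fourierCoeff_eq_zero_of_le hYI 0 (fun j => (j : ℤ)) Nat.cast_injective fun j => ?_
    induction j with
    | zero => simp
    | succ j ih =>
      have h1 := hrec ((j + 1 : ℕ) : ℤ)
      rw [if_neg (by omega), sub_eq_zero,
        show ((j + 1 : ℕ) : ℤ) - 1 = j by push_cast; ring] at h1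
      rw [h1, norm_mul, hnorm, one_mul] at ih
      exact ih
  have := hrec 0
  rw [if_pos rfl, h0, hneg _ (by omega)] at this
  exact hc (by simpa using this.symm)

theorem IsRatZero.eq_zero_of_integrable {ρ : RatFunc ℂ} (hρ : IsRatZero ρ)
    (h : Integrable (onCircle ρ) arc) : ρ = 0 := by
  have h1 := hρ.1
  rw [denom_eq_one_of_integrable hρ.2 h, degree_one] at h1
  exact RatFunc.num_eq_zero_iff.1 (degree_eq_bot.1 (Nat.WithBot.lt_zero_iff.1 h1))

/-! ### Uniqueness of the regular part, and polynomials as elements of `H^p`. -/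

section Toeplitz

variable {p : ℝ≥0∞} [Fact (1 ≤ p)]

/-- Two decompositions of `φ g` differ by an integrable element of `Rat₀`, which is zero; the images
then differ by a function both Hardy and co-Hardy. -/
theorem isSingleValued_toeplitz (hp : 1 < p) (φ : UnitAddCircle → ℂ) :
    IsSingleValued (toeplitz p φ) := by
  intro g k k' h h'
  obtain ⟨ρ, hρ, h⟩ := mem_toeplitz_iff.1 h
  obtain ⟨ρ', hρ', h'⟩ := mem_toeplitz_iff.1 h'
  have hsum : ∀ᵐ x ∂arc, onCircle (ρ + RatFunc.C (-1) * ρ') x = onCircle ρ x - onCircle ρ' x := by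
    filter_upwards [onCircle_add ρ (RatFunc.C (-1) * ρ'), onCircle_smul (-1) ρ'] with x h1 h2
    rw [h1, h2]; ring
  have hint : Integrable (onCircle (ρ + RatFunc.C (-1) * ρ')) arc := by
    refine (((h'.integrable.sub h.integrable).add (integrable_LpT (k' : LpT p))).sub
      (integrable_LpT (k : LpT p))).congr ?_
    filter_upwards [hsum] with x hx
    rw [hx]
    simp only [Pi.add_apply, Pi.sub_apply]
    ring
  have hzero := (hρ.add (hρ'.smul (-1))).eq_zero_of_integrable hint
  have hd : MemCoHardy p (fun x => (k : LpT p) x - (k' : LpT p) x) := by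
    refine (h'.sub h).congr ?_
    filter_upwards [hsum] with x hx
    rw [hzero, onCircle_zero] at hx
    linear_combination -hx
  refine hardy_ext ?_
  filter_upwards [((memHardy_coe k).sub (memHardy_coe k')).ae_eq_zero hp hd] with x hx
  exact sub_eq_zero.1 hx

theorem mem_toeplitz_iff_of_memLp {φ : UnitAddCircle → ℂ} {g k : Hardy p}
    (hm : MemLp (fun x => φ x * (g : LpT p) x) p arc) : (g, k) ∈ toeplitz p φ ↔
      MemCoHardy p (fun x => φ x * (g : LpT p) x - (k : LpT p) x) := by
  refine ⟨fun h => ?_, mem_toeplitz_of_memCoHardy⟩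
  obtain ⟨ρ, hρ, h⟩ := mem_toeplitz_iff.1 h
  have hint : Integrable (onCircle ρ) arc := by
    refine (((hm.integrable Fact.out).sub h.integrable).sub (integrable_LpT (k : LpT p))).congr
      (Eventually.of_forall fun x => ?_)
    simp only [Pi.sub_apply]
    ring
  rw [hρ.eq_zero_of_integrable hint] at h
  simpa only [onCircle_zero, sub_zero] using h

/-! ### Polynomials in Hardy spaces -/

theorem fourierCoeff_zpow_mul (k : ℤ) (u : UnitAddCircle → ℂ) (n : ℤ) :
    fourierCoeff (fun x => pt x ^ k * u x) n = fourierCoeff u (n - k) := by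
  refine integral_congr_ae (Eventually.of_forall fun x => ?_)
  have h : pt x ^ k = fourier k x := by
    rw [fourier_apply, AddCircle.toCircle_zsmul]; rfl
  simp only [smul_eq_mul, h]
  rw [← mul_assoc, ← fourier_add]
  congr 3
  ring

theorem continuous_zpow_pt (k : ℤ) : Continuous fun x => pt x ^ k :=
  continuous_pt.zpow₀ k fun x => Or.inl (pt_ne_zero x)

theorem fourierCoeff_eval (r : ℂ[X]) (n : ℕ) :
    fourierCoeff (fun x => r.eval (pt x)) n = r.coeff n := by
  induction r using Polynomial.induction_on' with
  | add r t hr ht =>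
    simp only [eval_add, coeff_add]
    rw [fourierCoeff_fun_add (memHardy_eval (p := 1) r).integrable
      (memHardy_eval (p := 1) t).integrable, hr, ht]
  | monomial m a =>
    simp only [eval_monomial]
    rw [fourierCoeff.const_mul, coeff_monomial]
    have h := fourierCoeff_zpow_mul m (fun _ => (1 : ℂ)) n
    simp only [zpow_natCast, mul_one] at h
    rw [h, fourierCoeff_const]
    by_cases hnm : m = n
    · simp [hnm]
    · rw [if_neg (by omega), if_neg hnm, mul_zero]

theorem eq_zero_of_ae_eval_eq_zero {r : ℂ[X]} (h : ∀ᵐ x ∂arc, r.eval (pt x) = 0) : r = 0 := by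
  by_contra hr
  obtain ⟨x, h1, h2⟩ := (h.and (ae_eval_ne_zero hr)).exists
  exact h2 h1

/-- For `d ≤ 0` the truncation `d.toNat = 0` leaves only `r = 0`, matching `deg 0 = -∞`. -/
theorem mem_degreeLT_toNat_iff {r : ℂ[X]} {d : ℤ} :
    r ∈ degreeLT ℂ d.toNat ↔ r = 0 ∨ (r.natDegree : ℤ) < d := by
  rw [mem_degreeLT]
  by_cases hr : r = 0
  · simp [hr]
  · rw [degree_eq_natDegree hr]
    simp only [hr, false_or, Nat.cast_lt]
    omega

/-- `z^{-d} u` has only coefficients of negative index, for `u` in `H^p`, precisely when `u` is a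
polynomial of degree less than `d`. -/
theorem memCoHardy_zpow_mul_iff (hp : 1 < p) {u : UnitAddCircle → ℂ} (hu : MemHardy p u) (d : ℤ) :
    MemCoHardy p (fun x => pt x ^ (-d) * u x) ↔
      ∃ r ∈ degreeLT ℂ d.toNat, ∀ᵐ x ∂arc, u x = r.eval (pt x) := by
  constructor
  · rintro ⟨-, h⟩
    -- The Taylor polynomial of `u` of degree below `d`; the hypothesis kills all later
    -- coefficients.
    set r : ℂ[X] := ∑ j ∈ Finset.range d.toNat, C (fourierCoeff u j) * X ^ j with hr
    have hcoeff : ∀ n : ℕ, r.coeff n = if n < d.toNat then fourierCoeff u n else 0 := by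
      intro n
      simp [hr, finsetSum_coeff, coeff_C_mul, coeff_X_pow]
    have hr' : r ∈ degreeLT ℂ d.toNat := by
      rw [mem_degreeLT, degree_lt_iff_coeff_zero]
      intro n hn
      rw [hcoeff, if_neg (by omega)]
    refine ⟨r, hr', ?_⟩
    have hd := hu.sub (memHardy_eval r)
    have hco : MemCoHardy p (fun x => u x - r.eval (pt x)) := by
      refine ⟨hd.1, fun n hn => ?_⟩
      obtain ⟨n, rfl⟩ := Int.eq_ofNat_of_zero_le hn
      rw [fourierCoeff_fun_sub hu.integrable (memHardy_eval (p := p) r).integrable,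
        fourierCoeff_eval, hcoeff]
      split_ifs with hlt
      · exact sub_self _
      · have h1 := h (n - d) (by omega)
        rw [fourierCoeff_zpow_mul] at h1
        rw [sub_zero, ← h1]
        congr 1
        ring
    filter_upwards [hd.ae_eq_zero hp hco] with x hx
    exact sub_eq_zero.1 hx
  · rintro ⟨r, hr, h⟩
    refine ⟨memLp_continuous_mul (continuous_zpow_pt _) hu.1, fun n hn => ?_⟩
    rw [fourierCoeff_zpow_mul, fourierCoeff_congr h]
    rcases lt_or_ge (n - -d) 0 with h0 | h0
    · exact (memHardy_eval (p := p) r).2 _ h0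
    · obtain ⟨j, hj⟩ := Int.eq_ofNat_of_zero_le h0
      rw [hj, fourierCoeff_eval]
      rw [mem_degreeLT, degree_lt_iff_coeff_zero] at hr
      exact hr j (by omega)

theorem coe_monomialH (j : ℕ) : ∀ᵐ x ∂arc, (monomialH p j : LpT p) x = pt x ^ j := by
  filter_upwards [coeFn_fourierLp (T := 1) p (j : ℤ)] with x hx
  change (fourierLp p (j : ℤ) : LpT p) x = _
  rw [hx, fourier_apply, AddCircle.toCircle_zsmul]
  simp [pt]

theorem polyProj_eq_eval (k : ℤ) (g : Hardy p) : ∃ r ∈ degreeLT ℂ k.toNat,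
    ∀ᵐ x ∂arc, (polyProj p k g : LpT p) x = r.eval (pt x) := by
  have key : ∀ N : ℕ, ∃ r ∈ degreeLT ℂ N, ∀ᵐ x ∂arc,
      (((∑ j ∈ Finset.range N, ((coeffL p j).comp (Hardy p).subtype).smulRight (monomialH p j) :
        Hardy p →ₗ[ℂ] Hardy p) g : Hardy p) : LpT p) x = r.eval (pt x) := by
    intro N
    induction N with
    | zero => exact ⟨0, zero_mem _, by simp⟩
    | succ N ih =>
      obtain ⟨r, hr, h⟩ := ih
      refine ⟨r + C (coeffL p N (g : LpT p)) * X ^ N, add_mem (degreeLT_mono N.le_succ hr) ?_, ?_⟩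
      · rw [mem_degreeLT]
        exact (degree_C_mul_X_pow_le N _).trans_lt (by exact_mod_cast N.lt_succ_self)
      · rw [Finset.sum_range_succ, LinearMap.add_apply]
        filter_upwards [h, hardy_coe_add (p := p) _ _, coe_monomialH (p := p) N,
          hardy_coe_smul (coeffL p N (g : LpT p)) (monomialH p N)] with x h1 h2 h3 h4
        rw [h2, h1]
        simp only [LinearMap.smulRight_apply, LinearMap.comp_apply, Submodule.subtype_apply] at h4 ⊢
        rw [h4, h3]
        simp
  exact key k.toNat

end Toeplitz

/-! ### The symbol and its factorization -/

/-- The rational function `ω = s / q` in lowest terms, with `s` and `q` factored according to the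
location of the roots with respect to the unit circle. -/
structure SymbolFactorization (ω : RatFunc ℂ) (s q sm s0 sp qm q0 qp : ℂ[X]) : Prop where
  eq_div : ω = algebraMap ℂ[X] (RatFunc ℂ) s / algebraMap ℂ[X] (RatFunc ℂ) q
  coprime : IsCoprime s q
  num_eq : s = sm * s0 * sp
  denom_eq : q = qm * q0 * qp
  sm_roots : ∀ z : ℂ, sm.IsRoot z → ‖z‖ < 1
  qm_roots : ∀ z : ℂ, qm.IsRoot z → ‖z‖ < 1
  s0_roots : ∀ z : ℂ, s0.IsRoot z → ‖z‖ = 1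
  q0_roots : ∀ z : ℂ, q0.IsRoot z → ‖z‖ = 1
  sp_roots : ∀ z : ℂ, sp.IsRoot z → 1 < ‖z‖
  qp_roots : ∀ z : ℂ, qp.IsRoot z → 1 < ‖z‖

namespace SymbolFactorization

variable {ω : RatFunc ℂ} {s q sm s0 sp qm q0 qp : ℂ[X]}

section

variable (F : SymbolFactorization ω s q sm s0 sp qm q0 qp)
include F

theorem sm_ne_zero : sm ≠ 0 := ne_zero_of_roots F.sm_roots (z := 1) (by simp)
theorem qm_ne_zero : qm ≠ 0 := ne_zero_of_roots F.qm_roots (z := 1) (by simp)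
theorem s0_ne_zero : s0 ≠ 0 := ne_zero_of_roots F.s0_roots (z := 0) (by simp)
theorem q0_ne_zero : q0 ≠ 0 := ne_zero_of_roots F.q0_roots (z := 0) (by simp)
theorem sp_ne_zero : sp ≠ 0 := ne_zero_of_roots F.sp_roots (z := 0) (by simp)
theorem qp_ne_zero : qp ≠ 0 := ne_zero_of_roots F.qp_roots (z := 0) (by simp)

theorem s_ne_zero : s ≠ 0 := by
  rw [F.num_eq]
  exact mul_ne_zero (mul_ne_zero F.sm_ne_zero F.s0_ne_zero) F.sp_ne_zero

theorem q_ne_zero : q ≠ 0 := by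
  rw [F.denom_eq]
  exact mul_ne_zero (mul_ne_zero F.qm_ne_zero F.q0_ne_zero) F.qp_ne_zero

theorem qm_eval_ne_zero (x : UnitAddCircle) : qm.eval (pt x) ≠ 0 :=
  eval_pt_ne_zero_of_lt_one F.qm_roots x

theorem qp_eval_ne_zero (x : UnitAddCircle) : qp.eval (pt x) ≠ 0 :=
  eval_pt_ne_zero_of_one_lt F.qp_roots x

theorem onCircle_eq_div : ∀ᵐ x ∂arc, onCircle ω x = s.eval (pt x) / q.eval (pt x) := by
  rw [F.eq_div]; exact onCircle_div s F.q_ne_zero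

theorem isCoprime_q0 : IsCoprime q0 (qm * qp) := by
  refine isCoprime_of_dvd _ _ (fun h => F.q0_ne_zero h.1) fun z hz hz0 h1 h2 => ?_
  obtain ⟨a, ha⟩ := IsAlgClosed.exists_root z fun h =>
    hz (isUnit_iff_degree_eq_zero.2 h)
  have h3 := F.q0_roots a (ha.dvd h1)
  rcases root_mul.1 (ha.dvd h2) with h | h
  · exact (F.qm_roots a h).ne h3
  · exact (F.qp_roots a h).ne' h3

theorem isCoprime_s_q0 : IsCoprime s q0 :=
  F.coprime.of_isCoprime_of_dvd_right ⟨qm * qp, by rw [F.denom_eq]; ring⟩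

end

/-! ### Polynomial test functions and the domain of the adjoint. -/

section Adjoint

variable {p p' : ℝ≥0∞} [Fact (1 ≤ p)] [Fact (1 ≤ p')]

/-- Dividing by `q` gives `ω f = B + c / q0`, so the image is the polynomial `B` itself. -/
theorem toHardy_mem_toeplitz (F : SymbolFactorization ω s q sm s0 sp qm q0 qp) {f B c : ℂ[X]}
    (h : s * f = (B * q0 + c) * (qm * qp)) (hc : c.degree < q0.degree) :
    ((memHardy_eval (p := p) f).toHardy, (memHardy_eval (p := p) B).toHardy)
      ∈ toeplitz p (onCircle ω) := by
  refine mem_toeplitz_iff.2 ⟨_, isRatZero_div hc F.q0_roots, ?_⟩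
  -- The co-Hardy remainder is exactly zero, presented as `0 * conj z`.
  refine ((memCoHardy_conj_pt (p := p)).const_mul 0).congr ?_
  filter_upwards [(memHardy_eval (p := p) f).coe_toHardy, (memHardy_eval (p := p) B).coe_toHardy,
    onCircle_div c F.q0_ne_zero, F.onCircle_eq_div, ae_eval_ne_zero F.q0_ne_zero]
    with x h1 h2 h3 h4 h5
  rw [h1, h2, h3, h4, F.denom_eq, eval_mul, eval_mul]
  have h6 := congrArg (Polynomial.eval (pt x)) h
  simp only [eval_mul, eval_add] at h6
  have h7 := F.qm_eval_ne_zero x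
  have h8 := F.qp_eval_ne_zero x
  field_simp
  linear_combination -h6

/-- On the circle `1 / r = conj (z ^ k) / conj (r^♯)` with `k = deg r`, and the roots of `r^♯` lie
outside the closed disc. -/
theorem hasRieszProj_div_eval {r : ℂ[X]} (hr : ∀ z : ℂ, r.IsRoot z → ‖z‖ < 1)
    {u : UnitAddCircle → ℂ} (hu : HasRieszProj p u) :
    HasRieszProj p (fun x => u x / r.eval (pt x)) := by
  refine ((hu.conj_eval_mul (X ^ r.natDegree)).div_conj_eval (one_lt_of_isRoot_sharp hr)).congr
    (Eventually.of_forall fun x => ?_)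
  have h := eval_pt_ne_zero_of_lt_one hr x
  have h1 : conj (pt x) ≠ 0 := (_root_.map_ne_zero _).2 (pt_ne_zero x)
  simp only [sharp_eval_pt, map_mul, map_pow, Complex.conj_conj, eval_pow, eval_X]
  field_simp

/-- Partial fractions: `s f / q = A / (qm qp) + c / q0` with `deg c < deg q0`. Hence the domain
contains all polynomials, which makes the adjoint single-valued. -/
theorem exists_toHardy_mem_toeplitz (F : SymbolFactorization ω s q sm s0 sp qm q0 qp) (f : ℂ[X]) :
    ∃ k, ((memHardy_eval (p := p) f).toHardy, k) ∈ toeplitz p (onCircle ω) := by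
  obtain ⟨α, β, hαβ⟩ := F.isCoprime_q0
  set c := (s * f * β) % q0
  set A := s * f * α + (s * f * β) / q0 * (qm * qp) with hA
  have hmod : q0 * ((s * f * β) / q0) + c = s * f * β := EuclideanDomain.div_add_mod _ _
  have hc : c.degree < q0.degree := EuclideanDomain.mod_lt _ F.q0_ne_zero
  have hsf : s * f = A * q0 + c * (qm * qp) := by
    rw [hA]; linear_combination -(s * f) * hαβ - (qm * qp) * hmod
  obtain ⟨k, hk, hk'⟩ := hasRieszProj_div_eval F.qm_roots
    ((memHardy_eval (p := p) A).div_eval F.qp_roots).hasRieszProj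
  refine ⟨hk.toHardy, mem_toeplitz_iff.2 ⟨_, isRatZero_div hc F.q0_roots, hk'.congr ?_⟩⟩
  filter_upwards [(memHardy_eval (p := p) f).coe_toHardy, hk.coe_toHardy,
    onCircle_div c F.q0_ne_zero, F.onCircle_eq_div, ae_eval_ne_zero F.q0_ne_zero]
    with x h1 h2 h3 h4 h5
  rw [h1, h2, h3, h4, F.denom_eq, eval_mul, eval_mul]
  have h6 := congrArg (Polynomial.eval (pt x)) hsf
  simp only [eval_mul, eval_add] at h6
  have h7 := F.qm_eval_ne_zero x
  have h8 := F.qp_eval_ne_zero x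
  congr 1
  field_simp
  linear_combination -h6

omit [Fact (1 ≤ p')] in
theorem pairing_toHardy_eval (r : ℂ[X]) (j : ℕ) (g : LpT p') :
    pairing ((memHardy_eval (p := p) (X ^ j * r)).toHardy : LpT p) g
      = conj (fourierCoeff (fun x => conj (r.eval (pt x)) * g x) j) := by
  rw [pairing, fourierCoeff, ← integral_conj]
  refine integral_congr_ae ?_
  filter_upwards [(memHardy_eval (p := p) (X ^ j * r)).coe_toHardy] with x hx
  rw [hx, fourier_neg, fourier_apply, AddCircle.toCircle_zsmul]
  simp only [eval_mul, eval_pow, eval_X, smul_eq_mul, map_mul, Complex.conj_conj]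
  simp only [zpow_natCast, Circle.coe_pow, pt]
  ring

variable [ENNReal.HolderConjugate p p']

theorem isSingleValued_adjoint (F : SymbolFactorization ω s q sm s0 sp qm q0 qp) (hp' : 1 < p') :
    IsSingleValued (adjoint (p' := p') (toeplitz p (onCircle ω))) := by
  intro g k k' h h'
  have hd : MemCoHardy p' (fun x => (k : LpT p') x - (k' : LpT p') x) := by
    refine ⟨(Lp.memLp _).sub (Lp.memLp _), fun n hn => ?_⟩
    obtain ⟨j, rfl⟩ := Int.eq_ofNat_of_zero_le hn
    -- The test function `z^j` recovers the `j`-th coefficient of any image of `g`.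
    obtain ⟨t, ht⟩ := F.exists_toHardy_mem_toeplitz (p := p) (X ^ j * 1)
    have h1 := (h _ _ ht).symm.trans (h' _ _ ht)
    simp only [pairing_toHardy_eval] at h1
    simp only [eval_one, map_one, one_mul] at h1
    rw [fourierCoeff_fun_sub (integrable_LpT _) (integrable_LpT _), sub_eq_zero]
    exact (starRingEnd ℂ).injective h1
  refine hardy_ext ?_
  filter_upwards [((memHardy_coe k).sub (memHardy_coe k')).ae_eq_zero hp' hd] with x hx
  exact sub_eq_zero.1 hx

theorem mem_polyMul_of_mem_adjoint (F : SymbolFactorization ω s q sm s0 sp qm q0 qp)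
    (hp' : 1 < p') {g k : Hardy p'} (h : (g, k) ∈ adjoint (toeplitz p (onCircle ω))) :
    g ∈ polyMul p' (sharp q0) := by
  obtain ⟨α, β, hαβ⟩ := F.isCoprime_s_q0
  have htest : ∀ {f B : ℂ[X]} {j : ℕ} (c : ℂ[X]),
      s * (X ^ j * f) = (X ^ j * B * q0 + c) * (qm * qp) → c.degree < q0.degree →
      fourierCoeff (fun x => conj (B.eval (pt x)) * (g : LpT p') x) j
        = fourierCoeff (fun x => conj (f.eval (pt x)) * (k : LpT p') x) j := by
    intro f B j c h1 h2
    have h3 := h _ _ (F.toHardy_mem_toeplitz (p := p) h1 h2)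
    simp only [pairing_toHardy_eval] at h3
    exact (starRingEnd ℂ).injective h3
  have hmul : ∀ (r : ℂ[X]) (e : Hardy p'),
      MemLp (fun x => conj (r.eval (pt x)) * (e : LpT p') x) p' arc := fun r e =>
    memLp_continuous_mul (Complex.continuous_conj.comp (continuous_eval_pt r)) (Lp.memLp _)
  have hint : ∀ (r : ℂ[X]) (e : Hardy p'),
      Integrable (fun x => conj (r.eval (pt x)) * (e : LpT p') x) arc := fun r e =>
    (hmul r e).integrable Fact.out
  -- Test function `z^j q`, whose image is `z^j s`.
  have hu : MemCoHardy p' (fun x => conj (s.eval (pt x)) * (g : LpT p') x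
      - conj (q.eval (pt x)) * (k : LpT p') x) := by
    refine ⟨(hmul s g).sub (hmul q k), fun n hn => ?_⟩
    obtain ⟨j, rfl⟩ := Int.eq_ofNat_of_zero_le hn
    rw [fourierCoeff_fun_sub (hint s g) (hint q k), sub_eq_zero]
    refine htest 0 (by rw [F.denom_eq]; ring) ?_
    rw [degree_zero]
    exact bot_lt_iff_ne_bot.2 (mt degree_eq_bot.1 F.q0_ne_zero)
  set v : UnitAddCircle → ℂ := fun x => conj (β.eval (pt x)) * (g : LpT p') x
      + conj ((qm * qp * α).eval (pt x)) * (k : LpT p') x with hv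
  have hvI : Integrable v arc := (hint β g).add (hint _ k)
  have hv0 : ∀ j : ℕ, j < q0.natDegree → fourierCoeff v j = 0 := by
    intro j hj
    -- By Bézout `s α = 1 - β q0`, so the image is `-z^j β` with singular part `z^j / q0`, strictly
    -- proper exactly when `j < deg q0`.
    have h1 := htest (f := qm * qp * α) (B := -β) (j := j) (X ^ j)
      (by linear_combination (X ^ j * (qm * qp)) * hαβ)
      (by rw [degree_X_pow, degree_eq_natDegree F.q0_ne_zero]; exact_mod_cast hj)
    rw [hv, fourierCoeff_fun_add (hint β g) (hint _ k), ← h1]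
    have h2 := fourierCoeff.const_mul
      (fun x => conj (β.eval (pt x)) * (g : LpT p') x) (-1) (j : ℤ)
    simp only [eval_neg, map_neg, neg_mul, one_mul] at h2 ⊢
    rw [h2, add_neg_cancel]
  obtain ⟨V, hV, hV'⟩ := (((memHardy_coe g).hasRieszProj.conj_eval_mul β).add
    ((memHardy_coe k).hasRieszProj.conj_eval_mul (qm * qp * α)))
  have hVlow : ∀ n : ℤ, n < q0.natDegree → fourierCoeff V n = 0 := by
    intro n hn
    rcases lt_or_ge n 0 with h0 | h0
    · exact hV.2 n h0
    · have h1 := hV'.2 n h0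
      obtain ⟨j, rfl⟩ := Int.eq_ofNat_of_zero_le h0
      have h2 : fourierCoeff v j - fourierCoeff V j = 0 :=
        (fourierCoeff_fun_sub hvI hV.integrable _).symm.trans h1
      rw [hv0 j (by exact_mod_cast hn)] at h2
      simpa using h2
  have hh : MemHardy p' (fun x => pt x ^ (-(q0.natDegree : ℤ)) * V x) :=
    ⟨memLp_continuous_mul (continuous_zpow_pt _) hV.1, fun n hn => by
      rw [fourierCoeff_zpow_mul]; exact hVlow _ (by omega)⟩
  have hsharp : ∀ x, (sharp q0).eval (pt x) * (pt x ^ (-(q0.natDegree : ℤ)) * V x)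
      = conj (q0.eval (pt x)) * V x := fun x => by
    have := pt_ne_zero x
    rw [sharp_eval_pt, zpow_neg, zpow_natCast]
    field_simp
  have hd := (memHardy_coe g).sub (hh.eval_mul (sharp q0))
  have hd' : MemCoHardy p' (fun x => (g : LpT p') x
      - (sharp q0).eval (pt x) * (pt x ^ (-(q0.natDegree : ℤ)) * V x)) := by
    -- Conjugated Bézout: `g = conj α · u + conj q0 · v`, where `u` is the co-Hardy function of
    -- `hu`.
    refine ((hu.conj_eval_mul α).add (hV'.conj_eval_mul q0)).congr
      (Eventually.of_forall fun x => ?_)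
    rw [hsharp]
    have h1 := congrArg (fun r => conj (Polynomial.eval (pt x) r)) hαβ
    simp only [eval_add, eval_mul, eval_one, map_add, map_mul, map_one, F.denom_eq] at h1 ⊢
    linear_combination ((g : LpT p') x) * h1
  refine ⟨hh.toHardy, ?_⟩
  filter_upwards [hd.ae_eq_zero hp' hd', hh.coe_toHardy] with x h1 h2
  rw [h2, sub_eq_zero.1 h1]

omit [Fact (1 ≤ p)] [Fact (1 ≤ p')] in
theorem integrable_conj_mul {u g : UnitAddCircle → ℂ} (hu : MemLp u p arc) (hg : MemLp g p' arc) :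
    Integrable (fun x => conj (g x) * u x) arc := by
  have : ENNReal.HolderConjugate p' p := ENNReal.HolderTriple.symm
  exact MemLp.integrable_mul (p := p') (q := p) (memLp_conj hg) hu

theorem mem_adjoint (F : SymbolFactorization ω s q sm s0 sp qm q0 qp) (hp : 1 < p) (hp' : 1 < p')
    {g h k : Hardy p'}
    (hg : ∀ᵐ x ∂arc, (g : LpT p') x = (sharp q0).eval (pt x) * (h : LpT p') x)
    (hk : MemCoHardy p' (fun x => starSymbol (onCircle ω) x * (g : LpT p') x - (k : LpT p') x)) :
    (g, k) ∈ adjoint (toeplitz p (onCircle ω)) := by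
  have hsymm : ENNReal.HolderConjugate p' p := ENNReal.HolderTriple.symm
  have hpt : p ≠ ∞ := (ENNReal.HolderConjugate.ne_top_iff_ne_one p p').2 hp'.ne'
  have hpt' : p' ≠ ∞ := (ENNReal.HolderConjugate.ne_top_iff_ne_one p' p).2 hp.ne'
  intro f t hft
  obtain ⟨ρ, hρ, hρ'⟩ := mem_toeplitz_iff.1 hft
  set σ := algebraMap ℂ[X] (RatFunc ℂ) q0 * ρ with hσ
  have hσc : ∀ᵐ x ∂arc, onCircle σ x = q0.eval (pt x) * onCircle ρ x := by
    filter_upwards [ae_eval_ne_zero ρ.denom_ne_zero] with x hx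
    have := RatFunc.eval_mul (RingHom.id ℂ) (pt x) (x := algebraMap ℂ[X] (RatFunc ℂ) q0) (y := ρ)
      (by simp) hx
    simpa [onCircle] using this
  -- `q0 ρ = s f / (qm qp) - q0 (ω f - ρ)`, and both terms are in `L^p`.
  have hσint : Integrable (onCircle σ) arc := by
    have h1 : MemLp (fun x => q0.eval (pt x) * (onCircle ω x * (f : LpT p) x - onCircle ρ x)) p arc :=
      memLp_continuous_mul (continuous_eval_pt q0)
        ((hρ'.1.add (Lp.memLp (t : LpT p))).ae_eq (Eventually.of_forall fun x => by
          simp only [Pi.add_apply]; ring))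
    have h2 := memLp_div_eval F.qp_eval_ne_zero (memLp_div_eval F.qm_eval_ne_zero
      (memLp_continuous_mul (continuous_eval_pt s) (Lp.memLp (f : LpT p))))
    refine ((h2.sub h1).integrable Fact.out).congr ?_
    filter_upwards [hσc, F.onCircle_eq_div, ae_eval_ne_zero F.q0_ne_zero] with x h3 h4 h5
    have h7 := F.qm_eval_ne_zero x
    have h8 := F.qp_eval_ne_zero x
    simp only [Pi.sub_apply]
    rw [h3, h4, F.denom_eq, eval_mul, eval_mul]
    field_simp
    ring
  have hσ1 : σ.denom = 1 := denom_eq_one_of_integrable (fun z hz => hρ.2 z (by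
    have := RatFunc.denom_mul_dvd (algebraMap ℂ[X] (RatFunc ℂ) q0) ρ
    rw [RatFunc.denom_algebraMap, one_mul] at this
    exact hz.dvd this)) hσint
  have hdeg : σ.num ∈ degreeLT ℂ (q0.natDegree : ℤ).toNat := by
    have h1 := RatFunc.num_denom_mul (algebraMap ℂ[X] (RatFunc ℂ) q0) ρ
    rw [RatFunc.denom_algebraMap, RatFunc.num_algebraMap, ← hσ, hσ1, one_mul, mul_one] at h1
    have h2 := congrArg degree h1
    rw [degree_mul, degree_mul] at h2
    rw [mem_degreeLT, Int.toNat_natCast, ← degree_eq_natDegree F.q0_ne_zero]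
    by_contra hcon
    rw [not_lt] at hcon
    have h3 : q0.degree + ρ.num.degree < q0.degree + ρ.denom.degree :=
      WithBot.add_lt_add_left (mt degree_eq_bot.1 F.q0_ne_zero) hρ.1
    rw [← h2] at h3
    exact absurd h3 (not_lt.2 (by gcongr))
  -- Since `conj (q0^♯) = z^{-m0} q0` on the circle, this is the factor paired with `h`; the bound
  -- `deg (q0 ρ) < m0` makes it co-Hardy.
  have hc := (memCoHardy_zpow_mul_iff hp (memHardy_eval (p := p) σ.num) q0.natDegree).2
    ⟨_, hdeg, Eventually.of_forall fun x => rfl⟩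
  have I1 := integrable_conj_mul hρ'.1 (Lp.memLp (g : LpT p'))
  have I2 := integrable_conj_mul (p := p') (p' := p) hk.1 (Lp.memLp (f : LpT p))
  have I3 := integrable_conj_mul hc.1 (Lp.memLp (h : LpT p'))
  have Z1 := integral_conj_mul_eq_zero hpt' hρ' (memHardy_coe g)
  have Z2 := integral_conj_mul_eq_zero hpt hk (memHardy_coe f)
  have Z3 := integral_conj_mul_eq_zero hpt' hc (memHardy_coe h)
  have I2' : Integrable (fun x => conj (conj ((f : LpT p) x) *
      (starSymbol (onCircle ω) x * (g : LpT p') x - (k : LpT p') x))) arc :=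
    LinearIsometryEquiv.integrable_comp_iff (RCLike.conjLIE (K := ℂ)) |>.2 I2
  have Z2' := (integral_conj (μ := arc)
    (f := fun x => conj ((f : LpT p) x) * (starSymbol (onCircle ω) x * (g : LpT p') x
      - (k : LpT p') x))).trans (congrArg conj Z2)
  rw [map_zero] at Z2'
  rw [← sub_eq_zero, pairing, pairing,
    ← integral_sub (integrable_pairing _ _) (integrable_pairing _ _)]
  -- The difference of the two pairings splits into three terms, each a Hardy function paired with a
  -- co-Hardy one, up to conjugation.
  have key : ∀ᵐ x ∂arc, conj ((g : LpT p') x) * (t : LpT p) x - conj ((k : LpT p') x) * (f : LpT p) x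
      = conj (conj ((f : LpT p) x) * (starSymbol (onCircle ω) x * (g : LpT p') x - (k : LpT p') x))
        - conj ((g : LpT p') x) * (onCircle ω x * (f : LpT p) x - onCircle ρ x - (t : LpT p) x)
        - conj ((h : LpT p') x) * (pt x ^ (-(q0.natDegree : ℤ)) * σ.num.eval (pt x)) := by
    filter_upwards [hg, hσc] with x h1 h2
    have h3 : σ.num.eval (pt x) = q0.eval (pt x) * onCircle ρ x := by
      rw [← h2, onCircle_eq, hσ1]; simp
    have h4 := pt_ne_zero x
    rw [h3, h1, starSymbol, sharp_eval_pt]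
    simp only [map_mul, map_sub, map_pow, Complex.conj_conj, conj_pt, zpow_neg, zpow_natCast, inv_pow]
    ring
  rw [integral_congr_ae key, integral_sub (f := fun x => conj (conj ((f : LpT p) x) *
      (starSymbol (onCircle ω) x * (g : LpT p') x - (k : LpT p') x))
    - conj ((g : LpT p') x) * (onCircle ω x * (f : LpT p) x - onCircle ρ x - (t : LpT p) x))
    (I2'.sub I1) I3, integral_sub I2' I1, Z1, Z3, Z2']
  simp

end Adjoint

end SymbolFactorization

/-! ### Counting zeroes and poles -/

theorem card_filter_roots {r : ℂ[X]} {P : ℂ → Prop} [DecidablePred P]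
    (h : ∀ z : ℂ, r.IsRoot z → P z) : (r.roots.filter P).card = r.natDegree := by
  rw [Multiset.filter_eq_self.2 fun z hz => h z (isRoot_of_mem_roots hz)]
  exact splits_iff_card_roots.1 (IsAlgClosed.splits r)

theorem card_filter_roots_eq_zero {r : ℂ[X]} {P : ℂ → Prop} [DecidablePred P]
    (h : ∀ z : ℂ, r.IsRoot z → ¬ P z) : (r.roots.filter P).card = 0 := by
  rw [Multiset.filter_eq_nil.2 fun z hz => h z (isRoot_of_mem_roots hz), Multiset.card_zero]

/-! ### Kernels and ranges of graphs -/

section Graph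

variable {E F : Type*} [AddCommGroup E] [Module ℂ E] [AddCommGroup F] [Module ℂ F]
  {A : Submodule ℂ (E × F)} {S : Submodule ℂ E}

theorem mem_dom {g : E} : g ∈ dom A ↔ ∃ k, (g, k) ∈ A := by simp [dom]

theorem mem_ran {k : F} : k ∈ ran A ↔ ∃ g, (g, k) ∈ A := by simp [ran]

theorem mem_ker {g : E} : g ∈ ker A ↔ (g, 0) ∈ A := by simp [ker]

theorem mem_restrict {g : E} {k : F} : (g, k) ∈ restrict A S ↔ (g, k) ∈ A ∧ g ∈ S := by
  simp [restrict]

theorem mem_image {k : F} : k ∈ image A S ↔ ∃ g ∈ S, (g, k) ∈ A := by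
  simp only [image, mem_ran, mem_restrict, and_comm]

theorem isInjective_iff_ker_eq_bot : IsInjective A ↔ ker A = ⊥ := by
  constructor
  · intro h
    refine (Submodule.eq_bot_iff _).2 fun g hg => ?_
    exact h g 0 0 (mem_ker.1 hg) A.zero_mem
  · intro h g g' k hg hg'
    have h1 : g - g' ∈ ker A := mem_ker.2 (by simpa using A.sub_mem hg hg')
    rw [h, Submodule.mem_bot] at h1
    exact sub_eq_zero.1 h1

end Graph

/-! ### Degree counts and the symbols on the circle. -/

namespace SymbolFactorization

variable {ω : RatFunc ℂ} {s q sm s0 sp qm q0 qp : ℂ[X]}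

section

variable (F : SymbolFactorization ω s q sm s0 sp qm q0 qp)
include F

theorem num_mul_eq : ω.num * q = s * ω.denom :=
  (RatFunc.num_mul_eq_mul_denom_iff F.q_ne_zero).2 F.eq_div

theorem associated_num : Associated ω.num s :=
  associated_of_dvd_dvd
    (ω.isCoprime_num_denom.dvd_of_dvd_mul_right ⟨q, F.num_mul_eq.symm⟩)
    (F.coprime.dvd_of_dvd_mul_right ⟨ω.denom, F.num_mul_eq⟩)

theorem associated_denom : Associated ω.denom q :=
  associated_of_dvd_dvd
    (ω.isCoprime_num_denom.symm.dvd_of_dvd_mul_left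
      ⟨s, by rw [F.num_mul_eq, mul_comm]⟩)
    (F.coprime.symm.dvd_of_dvd_mul_left ⟨ω.num, by rw [← F.num_mul_eq, mul_comm]⟩)

theorem numZerosDisc_eq : numZerosDisc ω = sm.natDegree := by
  have h : ω.num.roots = s.roots := F.associated_num.roots_eq
  have hs := F.s_ne_zero
  rw [numZerosDisc, h]
  rw [F.num_eq] at hs ⊢
  rw [roots_mul hs, roots_mul (left_ne_zero_of_mul hs), Multiset.filter_add, Multiset.filter_add,
    Multiset.card_add, Multiset.card_add, card_filter_roots F.sm_roots,
    card_filter_roots_eq_zero fun z hz => (F.s0_roots z hz).not_lt,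
    card_filter_roots_eq_zero fun z hz => (F.sp_roots z hz).not_gt]
  rfl

theorem numPolesClosedDisc_eq : numPolesClosedDisc ω = qm.natDegree + q0.natDegree := by
  have h : ω.denom.roots = q.roots := F.associated_denom.roots_eq
  have hq := F.q_ne_zero
  rw [numPolesClosedDisc, h]
  rw [F.denom_eq] at hq ⊢
  rw [roots_mul hq, roots_mul (left_ne_zero_of_mul hq), Multiset.filter_add, Multiset.filter_add,
    Multiset.card_add, Multiset.card_add, card_filter_roots fun z hz => (F.qm_roots z hz).le,
    card_filter_roots fun z hz => (F.q0_roots z hz).le,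
    card_filter_roots_eq_zero fun z hz => (F.qp_roots z hz).not_ge]
  rfl

theorem natDegree_num : s.natDegree = sm.natDegree + s0.natDegree + sp.natDegree := by
  rw [F.num_eq, natDegree_mul (mul_ne_zero F.sm_ne_zero F.s0_ne_zero) F.sp_ne_zero,
    natDegree_mul F.sm_ne_zero F.s0_ne_zero]

theorem natDegree_denom : q.natDegree = qm.natDegree + q0.natDegree + qp.natDegree := by
  rw [F.denom_eq, natDegree_mul (mul_ne_zero F.qm_ne_zero F.q0_ne_zero) F.qp_ne_zero,
    natDegree_mul F.qm_ne_zero F.q0_ne_zero]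

theorem sharp_sm_roots (z : ℂ) (hz : (sharp sm).IsRoot z) : 1 < ‖z‖ :=
  one_lt_of_isRoot_sharp F.sm_roots z hz

theorem sharp_qm_roots (z : ℂ) (hz : (sharp qm).IsRoot z) : 1 < ‖z‖ :=
  one_lt_of_isRoot_sharp F.qm_roots z hz

/-- The factor `q0^♯` cancels the circle poles of `ω^*`; the rest is a Hardy function acted on by
`conj s / conj qp`, so a Riesz projection exists. -/
theorem starSymbol_mul_sharp (h : UnitAddCircle → ℂ) :
    ∀ᵐ x ∂arc, starSymbol (onCircle ω) x * ((sharp q0).eval (pt x) * h x)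
      = conj (s.eval (pt x)) * ((X ^ (q0.natDegree + qm.natDegree) : ℂ[X]).eval (pt x) * h x
        / (sharp qm).eval (pt x)) / conj (qp.eval (pt x)) := by
  filter_upwards [F.onCircle_eq_div, ae_eval_ne_zero F.q0_ne_zero] with x h1 h2
  have h3 := pt_ne_zero x
  have h4 : conj (q0.eval (pt x)) ≠ 0 := (_root_.map_ne_zero _).2 h2
  have h5 : conj (qm.eval (pt x)) ≠ 0 := (_root_.map_ne_zero _).2 (F.qm_eval_ne_zero x)
  have h6 : conj (qp.eval (pt x)) ≠ 0 := (_root_.map_ne_zero _).2 (F.qp_eval_ne_zero x)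
  rw [starSymbol, h1, F.denom_eq, sharp_eval_pt, sharp_eval_pt]
  simp only [eval_mul, map_mul, map_div₀, eval_pow, eval_X, pow_add]
  field_simp

/-- Apart from a power of `z` the symbol is anti-analytic, because `m - n = -d + m_+ - n_+` with `d
= n_0 + n_- - m_0 - m_-`. This `d` is the index of the projection `Q`. -/
theorem rangeSymbol_eq (x : UnitAddCircle) :
    pt x ^ ((q.natDegree : ℤ) - (s.natDegree : ℤ)) * (sharp sp).eval (pt x) / (sharp qp).eval (pt x)
      = pt x ^ (-((s0.natDegree : ℤ) + sm.natDegree - q0.natDegree - qm.natDegree))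
        * conj (sp.eval (pt x)) / conj (qp.eval (pt x)) := by
  have h3 := pt_ne_zero x
  have h6 : conj (qp.eval (pt x)) ≠ 0 := (_root_.map_ne_zero _).2 (F.qp_eval_ne_zero x)
  have he : (q.natDegree : ℤ) - (s.natDegree : ℤ)
      = -((s0.natDegree : ℤ) + sm.natDegree - q0.natDegree - qm.natDegree)
        + qp.natDegree - sp.natDegree := by
    rw [F.natDegree_num, F.natDegree_denom]; push_cast; ring
  rw [he, zpow_sub₀ h3, zpow_add₀ h3, zpow_natCast, zpow_natCast, sharp_eval_pt, sharp_eval_pt]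
  field_simp

theorem rangeSymbol_mul_eq (h : UnitAddCircle → ℂ) :
    ∀ᵐ x ∂arc, pt x ^ ((q.natDegree : ℤ) - (s.natDegree : ℤ)) * (sharp sp).eval (pt x)
        / (sharp qp).eval (pt x) * ((sharp s0).eval (pt x) *
          ((sharp sm).eval (pt x) * h x / (sharp qm).eval (pt x)))
      = starSymbol (onCircle ω) x * ((sharp q0).eval (pt x) * h x) := by
  filter_upwards [F.starSymbol_mul_sharp h] with x hx
  have h3 := pt_ne_zero x
  have h5 : conj (qm.eval (pt x)) ≠ 0 := (_root_.map_ne_zero _).2 (F.qm_eval_ne_zero x)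
  have h6 : conj (qp.eval (pt x)) ≠ 0 := (_root_.map_ne_zero _).2 (F.qp_eval_ne_zero x)
  have he : -((s0.natDegree : ℤ) + sm.natDegree - q0.natDegree - qm.natDegree)
      = ((q0.natDegree + qm.natDegree : ℕ) : ℤ) - ((s0.natDegree + sm.natDegree : ℕ) : ℤ) := by
    push_cast; ring
  rw [hx, F.rangeSymbol_eq, he, zpow_sub₀ h3, zpow_natCast, zpow_natCast, sharp_eval_pt,
    sharp_eval_pt, sharp_eval_pt, F.num_eq]
  simp only [eval_mul, map_mul, eval_pow, eval_X, pow_add]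
  field_simp

end

/-! ### Riesz projections and vanishing for the two symbols. -/

section Range

variable {p : ℝ≥0∞} [Fact (1 ≤ p)]

theorem memHardy_symbol (F : SymbolFactorization ω s q sm s0 sp qm q0 qp)
    {h : UnitAddCircle → ℂ} (hh : MemHardy p h) :
    MemHardy p (fun x => (X ^ (q0.natDegree + qm.natDegree) : ℂ[X]).eval (pt x) * h x
        / (sharp qm).eval (pt x)) :=
  (hh.eval_mul _).div_eval F.sharp_qm_roots

theorem hasRieszProj_starSymbol_mul (F : SymbolFactorization ω s q sm s0 sp qm q0 qp)
    {h : UnitAddCircle → ℂ} (hh : MemHardy p h) :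
    HasRieszProj p (fun x => starSymbol (onCircle ω) x * ((sharp q0).eval (pt x) * h x)) :=
  (((F.memHardy_symbol hh).hasRieszProj.conj_eval_mul s).div_conj_eval F.qp_roots).congr
    ((F.starSymbol_mul_sharp h).mono fun _ hx => hx.symm)

theorem memLp_starSymbol_mul (F : SymbolFactorization ω s q sm s0 sp qm q0 qp)
    {h : UnitAddCircle → ℂ} (hh : MemHardy p h) :
    MemLp (fun x => starSymbol (onCircle ω) x * ((sharp q0).eval (pt x) * h x)) p arc := by
  obtain ⟨k, h1, h2⟩ := F.hasRieszProj_starSymbol_mul hh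
  exact (h2.1.add h1.1).ae_eq (Eventually.of_forall fun x => by simp)

/-- The symbol of the range formula maps polynomials of low degree to functions with only
coefficients of negative index. -/
theorem memCoHardy_rangeSymbol_mul (F : SymbolFactorization ω s q sm s0 sp qm q0 qp) (hp : 1 < p)
    {r : ℂ[X]} (hr : r ∈ degreeLT ℂ
      ((s0.natDegree : ℤ) + sm.natDegree - q0.natDegree - qm.natDegree).toNat) :
    MemCoHardy p (fun x => pt x ^ ((q.natDegree : ℤ) - (s.natDegree : ℤ))
      * (sharp sp).eval (pt x) / (sharp qp).eval (pt x) * r.eval (pt x)) := by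
  have h := (memCoHardy_zpow_mul_iff hp (memHardy_eval r) _).2
    ⟨r, hr, Eventually.of_forall fun x => rfl⟩
  refine ((h.conj_eval_mul sp).div_conj_eval F.qp_roots).congr (Eventually.of_forall fun x => ?_)
  rw [F.rangeSymbol_eq]
  ring

omit [Fact (1 ≤ p)] in
theorem memLp_rangeSymbol_mul (F : SymbolFactorization ω s q sm s0 sp qm q0 qp)
    {u : UnitAddCircle → ℂ} (hu : MemLp u p arc) :
    MemLp (fun x => pt x ^ ((q.natDegree : ℤ) - (s.natDegree : ℤ))
      * (sharp sp).eval (pt x) / (sharp qp).eval (pt x) * u x) p arc := by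
  refine (memLp_div_conj_eval F.qp_eval_ne_zero (memLp_continuous_mul
    (Complex.continuous_conj.comp (continuous_eval_pt sp))
      (memLp_continuous_mul (continuous_zpow_pt
        (-((s0.natDegree : ℤ) + sm.natDegree - q0.natDegree - qm.natDegree))) hu))).ae_eq
    (Eventually.of_forall fun x => ?_)
  simp only [F.rangeSymbol_eq, Function.comp_apply]
  ring

theorem memCoHardy_starSymbol_mul_iff (F : SymbolFactorization ω s q sm s0 sp qm q0 qp)
    (hp : 1 < p) {h : UnitAddCircle → ℂ} (hh : MemHardy p h) :
    MemCoHardy p (fun x => starSymbol (onCircle ω) x * ((sharp q0).eval (pt x) * h x)) ↔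
      ∃ r ∈ degreeLT ℂ ((sm.natDegree : ℤ) - qm.natDegree - q0.natDegree).toNat,
        ∀ᵐ x ∂arc, h x = (sharp qm).eval (pt x) * r.eval (pt x) / (sharp sm).eval (pt x) := by
  set w := fun x => (X ^ (q0.natDegree + qm.natDegree) : ℂ[X]).eval (pt x) * h x
        / (sharp qm).eval (pt x)
  have hw : MemHardy p w := F.memHardy_symbol hh
  have hu : MemHardy p (fun x => (sharp sm).eval (pt x) * h x / (sharp qm).eval (pt x)) :=
    (hh.eval_mul _).div_eval F.sharp_qm_roots
  have hsp : ∀ z : ℂ, (s0 * sp).IsRoot z → 1 ≤ ‖z‖ := fun z hz => by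
    rcases root_mul.1 hz with h | h
    · exact (F.s0_roots z h).ge
    · exact (F.sp_roots z h).le
  have hqp : ∀ x, conj (qp.eval (pt x)) ≠ 0 :=
    fun x => (_root_.map_ne_zero _).2 (F.qp_eval_ne_zero x)
  have heq : ∀ x, conj (sm.eval (pt x)) * w x
      = pt x ^ (-((sm.natDegree : ℤ) - qm.natDegree - q0.natDegree))
        * ((sharp sm).eval (pt x) * h x / (sharp qm).eval (pt x)) := fun x => by
    have h3 := pt_ne_zero x
    have he : -((sm.natDegree : ℤ) - qm.natDegree - q0.natDegree)
        = ((q0.natDegree + qm.natDegree : ℕ) : ℤ) - (sm.natDegree : ℤ) := by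
      push_cast; ring
    rw [he, zpow_sub₀ h3, zpow_natCast, zpow_natCast, sharp_eval_pt sm]
    simp only [w, eval_pow, eval_X]
    field_simp
  -- Cancelling `conj (s0 * sp)` is allowed even though `s0` vanishes on the circle, as the quotient
  -- is known to be in `L^p`.
  have hstep : MemCoHardy p (fun x => starSymbol (onCircle ω) x * ((sharp q0).eval (pt x) * h x)) ↔
      MemCoHardy p (fun x => conj (sm.eval (pt x)) * w x) := by
    constructor
    · intro H
      refine MemCoHardy.of_conj_eval_mul hsp (memLp_continuous_mul
        (Complex.continuous_conj.comp (continuous_eval_pt sm)) hw.1)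
        ((H.conj_eval_mul qp).congr ?_)
      filter_upwards [F.starSymbol_mul_sharp h] with x hx
      rw [hx, mul_div_cancel₀ _ (hqp x), F.num_eq]
      simp only [eval_mul, map_mul]
      ring
    · intro H
      refine ((H.conj_eval_mul (s0 * sp)).div_conj_eval F.qp_roots).congr ?_
      filter_upwards [F.starSymbol_mul_sharp h] with x hx
      rw [hx, F.num_eq]
      simp only [eval_mul, map_mul]
      ring
  rw [hstep]
  simp only [heq]
  rw [memCoHardy_zpow_mul_iff hp hu]
  refine exists_congr fun r => and_congr_right fun _ => ?_
  refine ⟨fun H => H.mono fun x hx => ?_, fun H => H.mono fun x hx => ?_⟩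
  all_goals
    have h1 := eval_pt_ne_zero_of_one_lt F.sharp_qm_roots x
    have h2 := eval_pt_ne_zero_of_one_lt F.sharp_sm_roots x
    first
    | rw [← hx]; field_simp
    | rw [hx]; field_simp

end Range

/-! ### Domain, range and kernel of the adjoint. -/

section Adjoint

variable {p p' : ℝ≥0∞} [Fact (1 ≤ p)] [Fact (1 ≤ p')] [ENNReal.HolderConjugate p p']

/-- Once `g = q0^♯ h`, the Riesz projection of `ω^* g` exists and is an image of `g`;
single-valuedness identifies it with `k`. -/
theorem mem_adjoint_iff (F : SymbolFactorization ω s q sm s0 sp qm q0 qp) (hp : 1 < p)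
    (hp' : 1 < p') {g k : Hardy p'} :
    (g, k) ∈ adjoint (toeplitz p (onCircle ω)) ↔ g ∈ polyMul p' (sharp q0) ∧
      MemCoHardy p' (fun x => starSymbol (onCircle ω) x * (g : LpT p') x - (k : LpT p') x) := by
  constructor
  · intro hgk
    have hg := F.mem_polyMul_of_mem_adjoint hp' hgk
    refine ⟨hg, ?_⟩
    obtain ⟨h, hh⟩ := hg
    obtain ⟨k', hk', hk⟩ := F.hasRieszProj_starSymbol_mul (memHardy_coe h)
    have hmem : MemCoHardy p' (fun x => starSymbol (onCircle ω) x * (g : LpT p') x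
        - (hk'.toHardy : LpT p') x) := by
      refine hk.congr ?_
      filter_upwards [hh, hk'.coe_toHardy] with x h1 h2
      rw [h1, h2]
    rwa [F.isSingleValued_adjoint hp' g k _ hgk (F.mem_adjoint hp hp' hh hmem)]
  · rintro ⟨⟨h, hh⟩, hk⟩
    exact F.mem_adjoint hp hp' hh hk

theorem dom_adjoint (F : SymbolFactorization ω s q sm s0 sp qm q0 qp) (hp : 1 < p)
    (hp' : 1 < p') :
    dom (adjoint (p' := p') (toeplitz p (onCircle ω))) = polyMul p' (sharp q0) := by
  ext g
  rw [mem_dom]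
  refine ⟨fun ⟨k, hk⟩ => F.mem_polyMul_of_mem_adjoint hp' hk, fun hg => ?_⟩
  obtain ⟨h, hh⟩ := hg
  obtain ⟨k, hk, hk'⟩ := F.hasRieszProj_starSymbol_mul (memHardy_coe h)
  refine ⟨hk.toHardy, F.mem_adjoint hp hp' hh (hk'.congr ?_)⟩
  filter_upwards [hh, hk.coe_toHardy] with x h1 h2
  rw [h1, h2]

theorem adjoint_eq_restrict (F : SymbolFactorization ω s q sm s0 sp qm q0 qp) (hp : 1 < p)
    (hp' : 1 < p') : adjoint (p' := p') (toeplitz p (onCircle ω))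
      = restrict (toeplitz p' (starSymbol (onCircle ω))) (polyMul p' (sharp q0)) := by
  ext ⟨g, k⟩
  rw [F.mem_adjoint_iff hp hp', mem_restrict, and_comm]
  refine and_congr_left fun hg => ?_
  obtain ⟨h, hh⟩ := hg
  refine (mem_toeplitz_iff_of_memLp ?_).symm
  exact (F.memLp_starSymbol_mul (memHardy_coe h)).ae_eq (hh.mono fun x hx => by simp only [hx])

theorem ran_adjoint (F : SymbolFactorization ω s q sm s0 sp qm q0 qp) (hp : 1 < p)
    (hp' : 1 < p') : ran (adjoint (p' := p') (toeplitz p (onCircle ω))) =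
      image (toeplitz p' (fun x => pt x ^ ((q.natDegree : ℤ) - (s.natDegree : ℤ)) *
          (sharp sp).eval (pt x) / (sharp qp).eval (pt x)))
        ((polyMul p' (sharp s0)).map
          (Qproj p' ((s0.natDegree : ℤ) + sm.natDegree - q0.natDegree - qm.natDegree))) := by
  set d : ℤ := (s0.natDegree : ℤ) + sm.natDegree - q0.natDegree - qm.natDegree with hd
  ext k
  rw [mem_ran, mem_image]
  constructor
  · rintro ⟨g, hg⟩
    obtain ⟨⟨h, hh⟩, hk⟩ := (F.mem_adjoint_iff hp hp').1 hg
    have hh' := ((memHardy_coe h).eval_mul (sharp sm)).div_eval F.sharp_qm_roots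
    have hG := hh'.eval_mul (sharp s0)
    obtain ⟨r, hr, hr'⟩ := polyProj_eq_eval d hG.toHardy
    refine ⟨Qproj p' d hG.toHardy, Submodule.mem_map_of_mem ⟨hh'.toHardy, ?_⟩,
      mem_toeplitz_of_memCoHardy ?_⟩
    · filter_upwards [hG.coe_toHardy, hh'.coe_toHardy] with x h1 h2
      rw [h1, h2]
    · refine (hk.sub (F.memCoHardy_rangeSymbol_mul hp' hr)).congr ?_
      filter_upwards [hr', hG.coe_toHardy, hardy_coe_sub hG.toHardy (polyProj p' d hG.toHardy),
        F.rangeSymbol_mul_eq (h : LpT p'), hh] with x h1 h2 h3 h4 h5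
      rw [Qproj, LinearMap.sub_apply, LinearMap.id_apply, h3, h1, h2, mul_sub, h4, h5]
      ring
  · rintro ⟨_, ⟨G, ⟨h', hh'⟩, rfl⟩, hk⟩
    rw [mem_toeplitz_iff_of_memLp (F.memLp_rangeSymbol_mul (Lp.memLp _))] at hk
    obtain ⟨r, hr, hr'⟩ := polyProj_eq_eval d G
    -- The inverse of `h ↦ sm^♯ h / qm^♯`; both polynomials have their roots outside the closed
    -- disc.
    have hh := ((memHardy_coe h').eval_mul (sharp qm)).div_eval F.sharp_sm_roots
    have hg := hh.eval_mul (sharp q0)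
    refine ⟨hg.toHardy, F.mem_adjoint hp hp' (h := hh.toHardy) ?_ ?_⟩
    · filter_upwards [hg.coe_toHardy, hh.coe_toHardy] with x h1 h2
      rw [h1, h2]
    · refine (hk.add (F.memCoHardy_rangeSymbol_mul hp' hr)).congr ?_
      filter_upwards [hr', hg.coe_toHardy, hardy_coe_sub G (polyProj p' d G), hh',
        F.rangeSymbol_mul_eq (fun x => (sharp qm).eval (pt x) * (h' : LpT p') x
          / (sharp sm).eval (pt x))] with x h1 h2 h3 h4 h5
      have h6 := eval_pt_ne_zero_of_one_lt F.sharp_qm_roots x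
      have h7 := eval_pt_ne_zero_of_one_lt F.sharp_sm_roots x
      rw [mul_div_cancel₀ _ h7, mul_div_cancel_left₀ _ h6] at h5
      rw [Qproj, LinearMap.sub_apply, LinearMap.id_apply, h3, h1, h2, h4, ← h5]
      ring

theorem mem_ker_adjoint_iff (F : SymbolFactorization ω s q sm s0 sp qm q0 qp) (hp : 1 < p)
    (hp' : 1 < p') {g : Hardy p'} : g ∈ ker (adjoint (toeplitz p (onCircle ω))) ↔
      ∃ r ∈ degreeLT ℂ ((sm.natDegree : ℤ) - qm.natDegree - q0.natDegree).toNat,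
        ∀ᵐ x ∂arc, (g : LpT p') x = (sharp qm).eval (pt x) * (sharp q0).eval (pt x)
          * r.eval (pt x) / (sharp sm).eval (pt x) := by
  rw [mem_ker, F.mem_adjoint_iff hp hp']
  constructor
  · rintro ⟨⟨h, hh⟩, hk⟩
    obtain ⟨r, hr, hr'⟩ := (F.memCoHardy_starSymbol_mul_iff hp' (memHardy_coe h)).1 (hk.congr (by
      filter_upwards [hh, hardy_coe_zero (p := p')] with x h1 h2
      rw [h1, h2, sub_zero]))
    refine ⟨r, hr, ?_⟩
    filter_upwards [hh, hr'] with x h1 h2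
    rw [h1, h2]
    ring
  · rintro ⟨r, hr, hg⟩
    have hh := ((memHardy_eval (p := p') r).eval_mul (sharp qm)).div_eval F.sharp_sm_roots
    have hk := (F.memCoHardy_starSymbol_mul_iff hp' hh).2
      ⟨r, hr, Eventually.of_forall fun x => rfl⟩
    refine ⟨⟨hh.toHardy, ?_⟩, hk.congr ?_⟩
    · filter_upwards [hg, hh.coe_toHardy] with x h1 h2
      rw [h1, h2]
      ring
    · filter_upwards [hg, hardy_coe_zero (p := p')] with x h1 h2
      rw [h1, h2]
      ring

theorem memHardy_kernel (F : SymbolFactorization ω s q sm s0 sp qm q0 qp) (r : ℂ[X]) :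
    MemHardy p (fun x => (sharp qm).eval (pt x) * (sharp q0).eval (pt x)
          * r.eval (pt x) / (sharp sm).eval (pt x)) := by
  simpa only [eval_mul] using (memHardy_eval (p := p) (sharp qm * sharp q0 * r)).div_eval
    F.sharp_sm_roots

/-- The parametrization of the kernel of the adjoint by polynomials. -/
noncomputable def kernelMap (F : SymbolFactorization ω s q sm s0 sp qm q0 qp) (p : ℝ≥0∞)
    [Fact (1 ≤ p)] : ℂ[X] →ₗ[ℂ] Hardy p where
  toFun r := (F.memHardy_kernel r).toHardy
  map_add' r t := by
    refine hardy_ext ?_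
    filter_upwards [hardy_coe_add (F.memHardy_kernel (p := p) r).toHardy
      (F.memHardy_kernel (p := p) t).toHardy, (F.memHardy_kernel (p := p) r).coe_toHardy,
      (F.memHardy_kernel (p := p) t).coe_toHardy,
      (F.memHardy_kernel (p := p) (r + t)).coe_toHardy] with x h1 h2 h3 h4
    rw [h1, h2, h3, h4, eval_add]
    ring
  map_smul' c r := by
    refine hardy_ext ?_
    filter_upwards [hardy_coe_smul c (F.memHardy_kernel (p := p) r).toHardy,
      (F.memHardy_kernel (p := p) r).coe_toHardy,
      (F.memHardy_kernel (p := p) (c • r)).coe_toHardy] with x h1 h2 h3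
    rw [RingHom.id_apply, h1, h2, h3, eval_smul, smul_eq_mul]
    ring

theorem kernelMap_injective (F : SymbolFactorization ω s q sm s0 sp qm q0 qp) :
    Function.Injective (F.kernelMap p) := by
  refine (injective_iff_map_eq_zero _).2 fun r hr => ?_
  refine eq_zero_of_ae_eval_eq_zero ?_
  filter_upwards [(F.memHardy_kernel (p := p) r).coe_toHardy, hardy_coe_zero (p := p),
    ae_eval_ne_zero F.q0_ne_zero] with x h1 h2 h3
  change ((F.kernelMap p r : Hardy p) : LpT p) x = _ at h1
  rw [hr, h2] at h1
  have h4 := eval_pt_ne_zero_of_one_lt F.sharp_qm_roots x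
  have h5 := eval_pt_ne_zero_of_one_lt F.sharp_sm_roots x
  have h6 : (sharp q0).eval (pt x) ≠ 0 := by
    rw [sharp_eval_pt]
    exact mul_ne_zero (pow_ne_zero _ (pt_ne_zero x)) ((_root_.map_ne_zero _).2 h3)
  have h7 := (div_eq_zero_iff.1 h1.symm).resolve_right h5
  exact (mul_eq_zero.1 h7).resolve_left (mul_ne_zero h4 h6)

theorem ker_adjoint_eq_map (F : SymbolFactorization ω s q sm s0 sp qm q0 qp) (hp : 1 < p)
    (hp' : 1 < p') : ker (adjoint (p' := p') (toeplitz p (onCircle ω))) =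
      (degreeLT ℂ ((sm.natDegree : ℤ) - qm.natDegree - q0.natDegree).toNat).map
        (F.kernelMap p') := by
  ext g
  rw [F.mem_ker_adjoint_iff hp hp', Submodule.mem_map]
  refine exists_congr fun r => and_congr_right fun _ => ?_
  have h1 := (F.memHardy_kernel (p := p') r).coe_toHardy
  constructor
  · intro hg
    refine hardy_ext ?_
    filter_upwards [h1, hg] with x h2 h3
    exact h2.trans h3.symm
  · rintro rfl
    exact h1

theorem finrank_ker_adjoint (F : SymbolFactorization ω s q sm s0 sp qm q0 qp) (hp : 1 < p)
    (hp' : 1 < p') : FiniteDimensional ℂ (ker (adjoint (p' := p') (toeplitz p (onCircle ω)))) ∧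
      Module.finrank ℂ (ker (adjoint (p' := p') (toeplitz p (onCircle ω)))) =
        ((sm.natDegree : ℤ) - qm.natDegree - q0.natDegree).toNat := by
  set N := ((sm.natDegree : ℤ) - qm.natDegree - q0.natDegree).toNat
  have e := (degreeLTEquiv ℂ N).symm.trans
    (Submodule.equivMapOfInjective _ (F.kernelMap_injective (p := p')) (degreeLT ℂ N))
  rw [F.ker_adjoint_eq_map hp hp']
  exact ⟨e.finiteDimensional, by rw [← e.finrank_eq, Module.finrank_fin_fun]⟩

end Adjoint

end SymbolFactorization

end ToeplitzLike

theorem theorem1p1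
    (p p' : ℝ≥0∞) [Fact (1 ≤ p)] [Fact (1 ≤ p')] [ENNReal.HolderConjugate p p']
    (hp : 1 < p) (hp_top : p < ∞)
    (ω : RatFunc ℂ) (s q sm s0 sp qm q0 qp : ℂ[X])
    (hω : ω = algebraMap ℂ[X] (RatFunc ℂ) s / algebraMap ℂ[X] (RatFunc ℂ) q)
    (hsq : IsCoprime s q)
    (hs : s = sm * s0 * sp) (hq : q = qm * q0 * qp)
    (hsm : ∀ z : ℂ, sm.IsRoot z → ‖z‖ < 1) (hqm : ∀ z : ℂ, qm.IsRoot z → ‖z‖ < 1)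
    (hs0 : ∀ z : ℂ, s0.IsRoot z → ‖z‖ = 1) (hq0 : ∀ z : ℂ, q0.IsRoot z → ‖z‖ = 1)
    (hsp : ∀ z : ℂ, sp.IsRoot z → 1 < ‖z‖) (hqp : ∀ z : ℂ, qp.IsRoot z → 1 < ‖z‖)
    (Tstar : Submodule ℂ (Hardy p' × Hardy p'))
    (hTstar : Tstar = adjoint (toeplitz p (onCircle ω))) :
    -- all operators involved are single-valued (in particular the adjoint is well defined)
    IsSingleValued (toeplitz p (onCircle ω)) ∧
    IsSingleValued Tstar ∧
    IsSingleValued (toeplitz p' (starSymbol (onCircle ω))) ∧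
    -- domain and action of the adjoint
    dom Tstar = polyMul p' (sharp q0) ∧
    polyMul p' (sharp q0) ≤ dom (toeplitz p' (starSymbol (onCircle ω))) ∧
    Tstar = restrict (toeplitz p' (starSymbol (onCircle ω))) (polyMul p' (sharp q0)) ∧
    -- range
    ran Tstar =
      image
        (toeplitz p' (fun x => pt x ^ ((q.natDegree : ℤ) - (s.natDegree : ℤ)) *
          (sharp sp).eval (pt x) / (sharp qp).eval (pt x)))
        ((polyMul p' (sharp s0)).map
          (Qproj p' ((s0.natDegree : ℤ) + sm.natDegree - q0.natDegree - qm.natDegree))) ∧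
    (s0.natDegree + sm.natDegree ≤ q0.natDegree + qm.natDegree →
      ran Tstar =
        image
          (toeplitz p' (fun x => pt x ^ ((q.natDegree : ℤ) - (s.natDegree : ℤ)) /
            (sharp qp).eval (pt x)))
          (polyMul p' (sharp (sp * s0)))) ∧
    -- kernel
    (∀ G : LpT p', (∃ hG : G ∈ Hardy p', (⟨G, hG⟩ : Hardy p') ∈ ker Tstar) ↔
      ∃ r : ℂ[X],
        (r = 0 ∨ (r.natDegree : ℤ) < (sm.natDegree : ℤ) - qm.natDegree - q0.natDegree) ∧
        ∀ᵐ x ∂arc, G x = (sharp qm).eval (pt x) * (sharp q0).eval (pt x) * r.eval (pt x) /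
          (sharp sm).eval (pt x)) ∧
    -- dimension of the kernel
    FiniteDimensional ℂ (ker Tstar) ∧
    (Module.finrank ℂ (ker Tstar) : ℤ) =
      max 0 ((numZerosDisc ω : ℤ) - (numPolesClosedDisc ω : ℤ)) ∧
    (Module.finrank ℂ (ker Tstar) : ℤ) =
      max 0 ((sm.natDegree : ℤ) - qm.natDegree - q0.natDegree) ∧
    -- injectivity
    (IsInjective Tstar ↔ numZerosDisc ω ≤ numPolesClosedDisc ω) := by
  have F : SymbolFactorization ω s q sm s0 sp qm q0 qp :=
    ⟨hω, hsq, hs, hq, hsm, hqm, hs0, hq0, hsp, hqp⟩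
  have hp' : 1 < p' := (ENNReal.HolderConjugate.lt_top_iff_one_lt p p').1 hp_top
  obtain ⟨hfin, hrank⟩ := F.finrank_ker_adjoint (p' := p') hp hp'
  have hran := F.ran_adjoint (p' := p') hp hp'
  subst hTstar
  refine ⟨isSingleValued_toeplitz hp _, F.isSingleValued_adjoint hp',
    isSingleValued_toeplitz hp' _, F.dom_adjoint hp hp', ?_, F.adjoint_eq_restrict hp hp',
    hran, ?_, ?_, hfin, ?_, ?_, ?_⟩
  · intro g hg
    rw [← F.dom_adjoint (p := p) hp hp', mem_dom] at hg
    obtain ⟨k, hk⟩ := hg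
    rw [F.adjoint_eq_restrict hp hp', mem_restrict] at hk
    exact mem_dom.2 ⟨k, hk.1⟩
  · intro hle
    have hQ : Qproj p' ((s0.natDegree : ℤ) + sm.natDegree - q0.natDegree - qm.natDegree)
        = LinearMap.id := by
      rw [Qproj, polyProj, Int.toNat_eq_zero.2 (by omega), Finset.range_zero, Finset.sum_empty,
        sub_zero]
    rw [hran, hQ, Submodule.map_id]
    ext k
    rw [mem_image, mem_image]
    constructor
    · rintro ⟨g, ⟨h, hh⟩, hk⟩
      -- Moving `sp^♯` from the symbol to the vector leaves their product unchanged, so the same `ρ`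
      -- serves.
      obtain ⟨ρ, hρ, hk⟩ := mem_toeplitz_iff.1 hk
      have hG := (memHardy_coe h).eval_mul (sharp (sp * s0))
      refine ⟨hG.toHardy, ⟨h, hG.coe_toHardy⟩, mem_toeplitz_iff.2 ⟨ρ, hρ, hk.congr ?_⟩⟩
      filter_upwards [hh, hG.coe_toHardy] with x h1 h2
      rw [h1, h2, sharp_mul, Polynomial.eval_mul]
      ring
    · rintro ⟨g, ⟨h, hh⟩, hk⟩
      obtain ⟨ρ, hρ, hk⟩ := mem_toeplitz_iff.1 hk
      have hG := (memHardy_coe h).eval_mul (sharp s0)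
      refine ⟨hG.toHardy, ⟨h, hG.coe_toHardy⟩, mem_toeplitz_iff.2 ⟨ρ, hρ, hk.congr ?_⟩⟩
      filter_upwards [hh, hG.coe_toHardy] with x h1 h2
      rw [h1, h2, sharp_mul, Polynomial.eval_mul]
      ring
  · intro G
    simp only [← mem_degreeLT_toNat_iff, F.mem_ker_adjoint_iff hp hp']
    constructor
    · rintro ⟨-, h⟩
      exact h
    · rintro ⟨r, hr, h⟩
      exact ⟨fun n hn => ((F.memHardy_kernel (p := p') r).congr
        (h.mono fun x hx => hx.symm)).2 n hn, r, hr, h⟩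
  · rw [hrank, F.numZerosDisc_eq, F.numPolesClosedDisc_eq]
    omega
  · rw [hrank]
    omega
  · rw [isInjective_iff_ker_eq_bot, ← Submodule.finrank_eq_zero (R := ℂ), hrank, F.numZerosDisc_eq,
      F.numPolesClosedDisc_eq]
    omega
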